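/- Fix a field $\mathbb K$ and a group of degrees $\Gamma$: $\Gamma=\mathbb Z$ or $\Gamma=\mathbb Z/2$ (or any abelian group with a chosen element $1$ and a homomorphism $\Gamma\to\mathbb Z/2$ sending $1$ to $1$, which defines the signs $(-1)^d$). All vector spaces are $\Gamma$-graded over $\mathbb K$, $(sV)^g=V^{g+1}$, and the Koszul sign rule is used. Let $A$ be a strictly unital $A_\infty$-algebra with operations $\mu^n:(sA)^{\otimes n}\to sA$ ($n\ge 1$) of degree $1$, unit $e$, and bar construction $\mathcal BA=\bigoplus_{n\ge0}(sA)^{\otimes n}$ with its deconcatenation coproduct and bar differential $b_A$. A (strictly unital, left) $A_\infty$-module is a graded vector space $M$ with a degree $1$ map $\mu_M:\mathcal BA\otimes M\to M$ such that $$\mu_M\circ\big[(1\otimes\mu_M)\circ(\Delta\otimes 1)+b_A\otimes1\big]=0,$$ with $\mu_M(e\otimes m)=m$ and $\mu_M(a_1\otimes\cdots\otimes a_n\otimes m)=0$ if $n\ge2$ and some $a_i=e$. In the DG category $A\text{-}\mathrm{Mod}_\infty$, $\mathrm{Hom}^d(M,N)$ consists of the degree $d$ linear maps $\phi:\mathcal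 BA\otimes M\to N$ that vanish whenever some $a_i=e$, with $$\partial\phi=\phi(1\otimes\mu_M)(\Delta\otimes1)+\phi(b_A\otimes1)-(-1)^{d}\mu_N(1\otimes\phi)(\Delta\otimes1),\qquad \psi\phi=\psi\circ(1\otimes\phi)\circ(\Delta\otimes 1).$$ Let $H^*(A\text{-}\mathrm{Mod}_\infty)$ be its graded cohomology category, with morphism spaces $H^d(\mathrm{Hom}(M,N))$. The ghost ideal $\mathcal G_A$ of $H^*(A\text{-}\mathrm{Mod}_\infty)$ consists of the classes $x:M\to N$ such that $x\circ y=0$ for all $y\in H^*(\mathrm{Hom}(A,M))$, where $A$ is regarded as a left module over itself. $\mathcal G_A^r$ is its $r$-th power: sums of $r$-fold composites of ghosts, through arbitrary intermediate $A_\infty$-modules ($\mathcal G_A^0$ is everything). The length filtration is $$\mathcal F^r\mathrm{Hom}(M,N)=\{\phi:\ \phi|_{(sA)^{\otimes n}\otimes M}=0\ \text{for all } n<r\},$$ and $F^r\subseteq H^*(\mathrm{Hom}(M,N))$ is the subspace of classes represented by a cocycle in $\mathcal F^r$. **Theorem.** For any strictly unital $A_\infty$-algebra $A$, any $r\ge0$,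 any $A_\infty$-modules $M,N$ over $A$ and any degree $d$, $$\mathcal G_A^r\,(M,N)^d=F^r\,(M,N)^d\quad\text{as subspaces of } H^d(\mathrm{Hom}_{A\text{-}\mathrm{Mod}_\infty}(M,N)),$$ that is, $\mathcal G_A^r=F^r$. -/

import Mathlib

universe u v w

noncomputable section

open Finset

/-- A group of degrees: an abelian group `Γ` with a distinguished degree `one` (the degree of a
differential) and a parity which makes `one` odd.  The standard examples are `ℤ` and `ℤ/2`. -/
class GradingGroup (Γ : Type w) [AddCommGroup Γ] where
  one : Γ
  parity : Γ →+ ZMod 2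
  parity_one : parity one = 1

instance : GradingGroup ℤ where
  one := 1
  parity := (Int.castRingHom (ZMod 2)).toAddMonoidHom
  parity_one := by simp

instance : GradingGroup (ZMod 2) where
  one := 1
  parity := AddMonoidHom.id _
  parity_one := rfl

section Signs

variable {Γ : Type w} [AddCommGroup Γ] [GradingGroup Γ]

/-- The distinguished degree `1`. -/
abbrev oneDeg (Γ : Type w) [AddCommGroup Γ] [GradingGroup Γ] : Γ := GradingGroup.one

/-- The Koszul sign `(-1)^{d g}`. -/
def koszul (d g : Γ) : ℤˣ :=
  (-1 : ℤˣ) ^ (GradingGroup.parity d * GradingGroup.parity g : ZMod 2)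

/-- The sign `(-1)^d`. -/
def sgn (d : Γ) : ℤˣ := (-1 : ℤˣ) ^ (GradingGroup.parity d : ZMod 2)

lemma koszul_add_left (d d' g : Γ) : koszul (d + d') g = koszul d g * koszul d' g := by
  simp [koszul, add_mul, uzpow_add]

lemma koszul_add_right (d g g' : Γ) : koszul d (g + g') = koszul d g * koszul d g' := by
  simp [koszul, mul_add, uzpow_add]

lemma koszul_zero_right (d : Γ) : koszul d 0 = 1 := by
  simp [koszul]

lemma koszul_oneDeg_right (d : Γ) : koszul d (oneDeg Γ) = sgn d := by
  simp [koszul, sgn, GradingGroup.parity_one]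

lemma sgn_add (d d' : Γ) : sgn (d + d') = sgn d * sgn d' := by
  simp [sgn, uzpow_add]

lemma sgn_oneDeg : sgn (oneDeg Γ) = -1 := by
  simp [sgn, GradingGroup.parity_one]

end Signs

/-- A `Γ`-graded vector space over `K`. -/
structure GrVect (K : Type u) [Field K] (Γ : Type w) [AddCommGroup Γ] [DecidableEq Γ] where
  carrier : Type v
  [acg : AddCommGroup carrier]
  [mod : Module K carrier]
  deg : Γ → Submodule K carrier
  internal : DirectSum.IsInternal deg

attribute [instance] GrVect.acg GrVect.mod

/-- `f [a₁, …, aₙ]` is `K`-linear in every `aᵢ`.  Such an `f` is the same thing as a linear map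
out of `⨁ₙ V^{⊗n}`, its value on `a₁ ⊗ ⋯ ⊗ aₙ` being `f [a₁, …, aₙ]`. -/
def IsMultilin (K : Type u) [Field K] {V : Type*} [AddCommGroup V] [Module K V]
    {W : Type*} [AddCommGroup W] [Module K W] (f : List V → W) : Prop :=
  (∀ (l l' : List V) (a b : V), f (l ++ (a + b) :: l') = f (l ++ a :: l') + f (l ++ b :: l')) ∧
  (∀ (l l' : List V) (c : K) (a : V), f (l ++ (c • a) :: l') = c • f (l ++ a :: l'))

section Bar

variable {K : Type u} [Field K] {Γ : Type w} [AddCommGroup Γ] [DecidableEq Γ] [GradingGroup Γ]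

/-- The list `l` consists of homogeneous elements whose degrees in the suspension `sV`
(where `(sV)^g = V^{g+1}`) are the members of `gs`. -/
def GrVect.HasSuspDegrees (V : GrVect.{u, v, w} K Γ) (l : List V.carrier) (gs : List Γ) : Prop :=
  List.Forall₂ (fun a g => a ∈ V.deg (g + oneDeg Γ)) l gs

/-- The decomposition of `V` as the direct sum of its homogeneous pieces. -/
def GrVect.decomp (V : GrVect.{u, v, w} K Γ) :
    (DirectSum Γ fun g => V.deg g) ≃ₗ[K] V.carrier :=
  LinearEquiv.ofBijective (DirectSum.coeLinearMap V.deg) V.internal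

/-- The linear map `a ↦ (-1)^{d |a|} a` where `|a|` is the degree of `a` in `sV`. -/
def GrVect.twist (V : GrVect.{u, v, w} K Γ) (d : Γ) : V.carrier →ₗ[K] V.carrier :=
  (DirectSum.toModule K Γ V.carrier
      (fun g => koszul d (g - oneDeg Γ) • (V.deg g).subtype)) ∘ₗ
    V.decomp.symm.toLinearMap

/-- Precomposition of `f` with the coderivation of the tensor coalgebra of `sV` determined by
the degree `1` operations `μ`:
`∑_{r,k} ± f [a₁, …, a_r, μ [a_{r+1}, …, a_{r+k}], a_{r+k+1}, …, aₙ]`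
with the sign `(-1)^{|a₁| + ⋯ + |a_r|}`, degrees being taken in `sV`. -/
def GrVect.insertOp (V : GrVect.{u, v, w} K Γ) (μ : List V.carrier → V.carrier)
    {W : Type*} [AddCommGroup W] (f : List V.carrier → W) (l : List V.carrier) : W :=
  ∑ r ∈ range (l.length + 1), ∑ k ∈ range (l.length - r + 1),
    f ((l.take r).map (V.twist (oneDeg Γ)) ++ μ ((l.drop r).take k) :: l.drop (r + k))

end Bar

/-- A strictly unital `A∞`-algebra. The element `μ [a₁, …, aₙ]` is `μⁿ(a₁ ⊗ ⋯ ⊗ aₙ)`, for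
`μⁿ : (sA)^{⊗n} → sA` of degree `1`, and there is no `μ⁰`. -/
structure AInfAlgebra (K : Type u) [Field K] (Γ : Type w) [AddCommGroup Γ] [DecidableEq Γ]
    [GradingGroup Γ] extends GrVect.{u, v, w} K Γ where
  μ : List carrier → carrier
  multilin : IsMultilin K μ
  μ_nil : μ [] = 0
  degree : ∀ (l : List carrier) (gs : List Γ), toGrVect.HasSuspDegrees l gs →
    μ l ∈ deg ((gs.sum + oneDeg Γ) + oneDeg Γ)
  relation : ∀ l : List carrier, toGrVect.insertOp μ μ l = 0
  /-- the strict unit, of degree `0` in `A` -/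
  e : carrier
  e_mem : e ∈ deg 0
  unit_left : ∀ a : carrier, μ [e, a] = a
  unit_right : ∀ (g : Γ) (a : carrier), a ∈ deg (g + oneDeg Γ) → μ [a, e] = -(sgn g • a)
  unit_zero : ∀ l l' : List carrier, l.length + l'.length + 1 ≠ 2 → μ (l ++ e :: l') = 0

variable {K : Type u} [Field K] {Γ : Type w} [AddCommGroup Γ] [DecidableEq Γ] [GradingGroup Γ]

/-- For `f : BA ⊗ N → P` and `g : BA ⊗ M → N` with `g` of degree `d`, the map
`f ∘ (1 ⊗ g) ∘ Δ : BA ⊗ M → P`, that is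
`∑_i (-1)^{d(|a₁| + ⋯ + |a_i|)} f [a₁, …, a_i] (g [a_{i+1}, …, aₙ] m)`,
degrees of the `a_j` being taken in `sA`. Here a map `BA ⊗ M → N` is written as a
multilinear function from lists in `A` to linear maps `M → N`. -/
def AInfAlgebra.conv (A : AInfAlgebra.{u, v, w} K Γ) {M N P : Type*}
    [AddCommGroup M] [Module K M] [AddCommGroup N] [Module K N] [AddCommGroup P] [Module K P]
    (d : Γ) (f : List A.carrier → N →ₗ[K] P) (g : List A.carrier → M →ₗ[K] N)
    (l : List A.carrier) : M →ₗ[K] P :=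
  ∑ i ∈ range (l.length + 1), f ((l.take i).map (A.twist d)) ∘ₗ g (l.drop i)

/-- Precomposition of `f : BA ⊗ M → N` (or of `f : BA → W`) with the bar differential of `A`. -/
abbrev AInfAlgebra.barD (A : AInfAlgebra.{u, v, w} K Γ) {W : Type*} [AddCommGroup W]
    (f : List A.carrier → W) : List A.carrier → W :=
  A.insertOp A.μ f

/-- A strictly unital left `A∞`-module `M` over `A`, with structure map
`μ : BA ⊗ M → M` of degree `1`. -/
structure AInfModule (A : AInfAlgebra.{u, v, w} K Γ) extends GrVect.{u, v, w} K Γ where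
  μ : List A.carrier → carrier →ₗ[K] carrier
  multilin : IsMultilin K μ
  degree : ∀ (l : List A.carrier) (gs : List Γ), A.HasSuspDegrees l gs →
    ∀ (h : Γ) (m : carrier), m ∈ deg h → μ l m ∈ deg (gs.sum + h + oneDeg Γ)
  relation : ∀ l : List A.carrier, A.conv (oneDeg Γ) μ μ l + A.barD μ l = 0
  unit_one : μ [A.e] = LinearMap.id
  unit_zero : ∀ l l' : List A.carrier, l.length + l'.length ≠ 0 → μ (l ++ A.e :: l') = 0

section Lemmas

lemma units_smul_mem {V : Type*} [AddCommGroup V] [Module K V] (S : Submodule K V) (ε : ℤˣ)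
    {a : V} (h : a ∈ S) : ε • a ∈ S := by
  rcases Int.units_eq_one_or ε with rfl | rfl
  · simpa using h
  · simpa [Units.smul_def] using h

lemma units_smul_smul {V : Type*} [AddCommGroup V] [Module K V] (ε : ℤˣ) (c : K) (a : V) :
    ε • c • a = c • ε • a := by
  rcases Int.units_eq_one_or ε with rfl | rfl <;> simp [Units.smul_def]

lemma units_map_smul {V W : Type*} [AddCommGroup V] [AddCommGroup W] (f : V →+ W) (ε : ℤˣ)
    (a : V) : f (ε • a) = ε • f a := by
  rcases Int.units_eq_one_or ε with rfl | rfl <;> simp [Units.smul_def]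

section Multi

variable {V : Type*} [AddCommGroup V] [Module K V] {W : Type*} [AddCommGroup W] [Module K W]

lemma IsMultilin.units {f : List V → W} (hf : IsMultilin K f) (l l' : List V) (ε : ℤˣ) (a : V) :
    f (l ++ (ε • a) :: l') = ε • f (l ++ a :: l') := by
  rcases Int.units_eq_one_or ε with rfl | rfl
  · simp
  · have := hf.2 l l' (-1) a
    simpa [Units.smul_def] using this

lemma IsMultilin.zero {f : List V → W} (hf : IsMultilin K f) (l l' : List V) :
    f (l ++ 0 :: l') = 0 := by
  simpa using hf.2 l l' 0 0

lemma IsMultilin.prefix {f : List V → W} (hf : IsMultilin K f) (p : List V) :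
    IsMultilin K (fun t => f (p ++ t)) :=
  ⟨fun l l' a b => by simpa using hf.1 (p ++ l) l' a b,
   fun l l' c a => by simpa using hf.2 (p ++ l) l' c a⟩

lemma IsMultilin.cons {f : List V → W} (hf : IsMultilin K f) (p : V) :
    IsMultilin K (fun t => f (p :: t)) := hf.prefix [p]

lemma IsMultilin.comp_map {f : List V → W} (hf : IsMultilin K f) (T : V →ₗ[K] V) :
    IsMultilin K (fun t => f (t.map T)) :=
  ⟨fun l l' a b => by simpa using hf.1 (l.map T) (l'.map T) (T a) (T b),
   fun l l' c a => by simpa using hf.2 (l.map T) (l'.map T) c (T a)⟩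

lemma IsMultilin.comp_linear {W' : Type*} [AddCommGroup W'] [Module K W']
    {f : List V → W} (hf : IsMultilin K f) (T : W →ₗ[K] W') :
    IsMultilin K (fun t => T (f t)) :=
  ⟨fun l l' a b => by simp [hf.1], fun l l' c a => by simp [hf.2]⟩

end Multi

namespace GrVect

variable (V : GrVect.{u, v, w} K Γ)

lemma twist_of_mem (d : Γ) {g : Γ} {a : V.carrier} (h : a ∈ V.deg g) :
    V.twist d a = koszul d (g - oneDeg Γ) • a := by
  have h1 : V.decomp.symm a = DirectSum.lof K Γ (fun i => V.deg i) g ⟨a, h⟩ := by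
    rw [LinearEquiv.symm_apply_eq]
    exact (DirectSum.coeLinearMap_lof (A := V.deg) g ⟨a, h⟩).symm
  simp only [twist, LinearMap.comp_apply, LinearEquiv.coe_coe, h1, DirectSum.toModule_lof]
  rfl

lemma twist_of_susp (d : Γ) {g : Γ} {a : V.carrier} (h : a ∈ V.deg (g + oneDeg Γ)) :
    V.twist d a = koszul d g • a := by
  rw [V.twist_of_mem d h, add_sub_cancel_right]

lemma induction_hom {P : V.carrier → Prop} (a : V.carrier)
    (hom : ∀ g, ∀ x ∈ V.deg (g + oneDeg Γ), P x) (zero : P 0)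
    (add : ∀ x y, P x → P y → P (x + y)) : P a := by
  have ha : a ∈ ⨆ g, V.deg g := by
    rw [V.internal.submodule_iSup_eq_top]; trivial
  refine Submodule.iSup_induction V.deg (motive := P) ha (fun g x hx => ?_) zero add
  exact hom (g - oneDeg Γ) x (by simpa using hx)

lemma twist_add (d d' : Γ) (a : V.carrier) : V.twist (d + d') a = V.twist d (V.twist d' a) := by
  refine V.induction_hom (P := fun a => V.twist (d + d') a = V.twist d (V.twist d' a)) a
    (fun g x hx => ?_) (by simp only [map_zero]) (fun x y hx hy => by simp only [map_add, hx, hy])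
  rw [V.twist_of_susp _ hx, V.twist_of_susp d' hx,
    V.twist_of_susp d (units_smul_mem _ _ hx), koszul_add_left, mul_smul]

lemma twist_comm (d d' : Γ) (a : V.carrier) : V.twist d (V.twist d' a) = V.twist d' (V.twist d a) := by
  rw [← twist_add, ← twist_add, add_comm]

lemma HasSuspDegrees.twist {V : GrVect.{u, v, w} K Γ} {l : List V.carrier} {gs : List Γ}
    (h : V.HasSuspDegrees l gs) (d : Γ) : V.HasSuspDegrees (l.map (V.twist d)) gs := by
  induction h with
  | nil => exact List.Forall₂.nil
  | cons hx _ ih =>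
    refine List.Forall₂.cons ?_ ih
    rw [V.twist_of_susp d hx]
    exact units_smul_mem _ _ hx

/-- Multilinear functions that agree on homogeneous entries agree. -/
lemma ext_hom {W : Type*} [AddCommGroup W] [Module K W] {f g : List V.carrier → W}
    (hf : IsMultilin K f) (hg : IsMultilin K g)
    (h : ∀ l gs, V.HasSuspDegrees l gs → f l = g l) (l : List V.carrier) : f l = g l := by
  suffices H : ∀ (l p : List V.carrier) gs, V.HasSuspDegrees p gs → f (p ++ l) = g (p ++ l) from
    H l [] [] List.Forall₂.nil
  intro l
  induction l with
  | nil => intro p gs hp; simpa using h p gs hp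
  | cons a l ih =>
    intro p gs hp
    refine V.induction_hom (P := fun a => f (p ++ a :: l) = g (p ++ a :: l)) a ?_ ?_ ?_
    · intro g' x hx
      have := ih (p ++ [x]) (gs ++ [g'])
        (List.rel_append hp (List.Forall₂.cons hx List.Forall₂.nil))
      simpa using this
    · rw [hf.zero, hg.zero]
    · intro x y hx hy
      rw [hf.1, hg.1, hx, hy]

lemma map_twist_hom {W : Type*} [AddCommGroup W] [Module K W] {f : List V.carrier → W}
    (hf : IsMultilin K f) (d : Γ) {l : List V.carrier} {gs : List Γ}
    (h : V.HasSuspDegrees l gs) : f (l.map (V.twist d)) = koszul d gs.sum • f l := by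
  induction h generalizing f with
  | nil => simp [koszul_zero_right]
  | @cons x g l gs hx _ ih =>
    rw [List.map_cons, V.twist_of_susp d hx]
    have h1 := hf.units [] (l.map (V.twist d)) (koszul d g) x
    simp only [List.nil_append] at h1
    rw [h1, ih (hf.cons x), List.sum_cons, koszul_add_right, mul_smul]

lemma insertOp_cons (μ : List V.carrier → V.carrier) {W : Type*} [AddCommGroup W]
    (f : List V.carrier → W) (a : V.carrier) (l : List V.carrier) :
    V.insertOp μ f (a :: l) = V.insertOp μ (fun t => f (V.twist (oneDeg Γ) a :: t)) l +
      ∑ k ∈ range (l.length + 2), f (μ ((a :: l).take k) :: (a :: l).drop k) := by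
  rw [insertOp, List.length_cons, sum_range_succ']
  congr 1
  · refine sum_congr rfl fun r _ => ?_
    rw [Nat.add_sub_add_right]
    refine sum_congr rfl fun k _ => ?_
    rw [show r + 1 + k = (r + k) + 1 by omega]
    simp
  · simp

lemma insertOp_add (μ : List V.carrier → V.carrier) {W : Type*} [AddCommGroup W]
    (f f' : List V.carrier → W) :
    V.insertOp μ (f + f') = V.insertOp μ f + V.insertOp μ f' := by
  ext l; simp [insertOp, sum_add_distrib]

lemma insertOp_nil (μ : List V.carrier → V.carrier) {W : Type*} [AddCommGroup W]
    (f : List V.carrier → W) : V.insertOp μ f [] = f [μ []] := by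
  simp [insertOp]

end GrVect

namespace AInfAlgebra

variable (A : AInfAlgebra.{u, v, w} K Γ)

lemma μ_twist (d : Γ) (l : List A.carrier) :
    A.μ (l.map (A.twist d)) = sgn d • A.twist d (A.μ l) := by
  refine A.ext_hom (f := fun l => A.μ (l.map (A.twist d)))
    (g := fun l => sgn d • A.twist d (A.μ l)) (A.multilin.comp_map _)
    ⟨fun l l' a b => ?_, fun l l' c a => ?_⟩ (fun l gs h => ?_) l
  · show sgn d • A.twist d (A.μ _) = sgn d • A.twist d (A.μ _) + sgn d • A.twist d (A.μ _)
    rw [A.multilin.1, map_add, smul_add]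
  · show sgn d • A.twist d (A.μ _) = c • sgn d • A.twist d (A.μ _)
    rw [A.multilin.2, map_smul, units_smul_smul]
  · show A.μ (l.map (A.twist d)) = sgn d • A.twist d (A.μ l)
    rw [A.map_twist_hom A.multilin d h, A.twist_of_susp d (A.degree l gs h), koszul_add_right,
      koszul_oneDeg_right, ← mul_smul, mul_comm (koszul _ _), ← mul_assoc, Int.units_mul_self, one_mul]

lemma twist_e (d : Γ) : A.twist d A.e = koszul d (0 - oneDeg Γ) • A.e := A.twist_of_mem d A.e_mem

section Conv

variable {M N P Q : Type*} [AddCommGroup M] [Module K M] [AddCommGroup N] [Module K N]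
  [AddCommGroup P] [Module K P] [AddCommGroup Q] [Module K Q]

lemma conv_cons (d : Γ) (f : List A.carrier → N →ₗ[K] P) (g : List A.carrier → M →ₗ[K] N)
    (a : A.carrier) (l : List A.carrier) :
    A.conv d f g (a :: l) = f [] ∘ₗ g (a :: l) + A.conv d (fun t => f (A.twist d a :: t)) g l := by
  rw [conv, List.length_cons, sum_range_succ', add_comm]
  simp [conv]

lemma conv_split (d : Γ) (f : List A.carrier → N →ₗ[K] P) (g : List A.carrier → M →ₗ[K] N)
    (l : List A.carrier) (a : A.carrier) (l' : List A.carrier) :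
    A.conv d f g (l ++ a :: l') =
      ∑ i ∈ range (l.length + 1), f ((l.take i).map (A.twist d)) ∘ₗ g (l.drop i ++ a :: l') +
      A.conv d (fun t => f (l.map (A.twist d) ++ A.twist d a :: t)) g l' := by
  induction l generalizing f with
  | nil => simp [conv_cons]
  | cons b l ih =>
    rw [List.cons_append, conv_cons, ih, List.length_cons, sum_range_succ' _ (l.length + 1),
      ← add_assoc]
    congr 1
    rw [add_comm]
    simp

lemma conv_add_left (d : Γ) (f f' : List A.carrier → N →ₗ[K] P) (g : List A.carrier → M →ₗ[K] N) :
    A.conv d (f + f') g = A.conv d f g + A.conv d f' g := by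
  ext l; simp [conv, LinearMap.add_comp, sum_add_distrib]

lemma conv_smul_left (d : Γ) (c : K) (f : List A.carrier → N →ₗ[K] P)
    (g : List A.carrier → M →ₗ[K] N) : A.conv d (c • f) g = c • A.conv d f g := by
  ext l; simp [conv, smul_sum]

lemma conv_add_right (d : Γ) (f : List A.carrier → N →ₗ[K] P) (g g' : List A.carrier → M →ₗ[K] N) :
    A.conv d f (g + g') = A.conv d f g + A.conv d f g' := by
  ext l; simp [conv, sum_add_distrib]

lemma conv_smul_right (d : Γ) (c : K) (f : List A.carrier → N →ₗ[K] P)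
    (g : List A.carrier → M →ₗ[K] N) : A.conv d f (c • g) = c • A.conv d f g := by
  ext l; simp [conv, smul_sum]

/-- `conv` as a bilinear map. -/
def convₗ (d : Γ) : (List A.carrier → N →ₗ[K] P) →ₗ[K] (List A.carrier → M →ₗ[K] N) →ₗ[K]
    (List A.carrier → M →ₗ[K] P) :=
  LinearMap.mk₂ K (A.conv d) (A.conv_add_left d) (A.conv_smul_left d) (A.conv_add_right d)
    (A.conv_smul_right d)

@[simp] lemma convₗ_apply (d : Γ) (f : List A.carrier → N →ₗ[K] P)
    (g : List A.carrier → M →ₗ[K] N) : A.convₗ d f g = A.conv d f g := rfl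

lemma barD_add {W : Type*} [AddCommGroup W] (f f' : List A.carrier → W) :
    A.barD (f + f') = A.barD f + A.barD f' := A.insertOp_add _ f f'

lemma barD_smul {W : Type*} [AddCommGroup W] [Module K W] (c : K) (f : List A.carrier → W) :
    A.barD (c • f) = c • A.barD f := by
  ext l; simp [GrVect.insertOp, smul_sum]

lemma conv_isMultilin (d : Γ) {f : List A.carrier → N →ₗ[K] P} {g : List A.carrier → M →ₗ[K] N}
    (hf : IsMultilin K f) (hg : IsMultilin K g) : IsMultilin K (A.conv d f g) := by
  constructor
  · intro l l' a b
    simp only [conv_split]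
    simp only [conv, hf.1, map_add, LinearMap.add_comp, sum_add_distrib, hg.1,
      LinearMap.comp_add]
    abel
  · intro l l' c a
    simp only [conv_split]
    simp only [conv, hf.2, map_smul, LinearMap.smul_comp, hg.2,
      LinearMap.comp_smul, smul_add, smul_sum]

lemma conv_unital (d : Γ) {f : List A.carrier → N →ₗ[K] P} {g : List A.carrier → M →ₗ[K] N}
    (hf : IsMultilin K f) (hf' : ∀ l l', f (l ++ A.e :: l') = 0)
    (hg : ∀ l l', g (l ++ A.e :: l') = 0) (l l' : List A.carrier) :
    A.conv d f g (l ++ A.e :: l') = 0 := by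
  rw [conv_split]
  simp [conv, twist_e, hf.units, hf', hg]

lemma conv_assoc (d d' : Γ) (f : List A.carrier → P →ₗ[K] Q) (g : List A.carrier → N →ₗ[K] P)
    (h : List A.carrier → M →ₗ[K] N) :
    A.conv d (A.conv d' f g) h = A.conv (d' + d) f (A.conv d g h) := by
  ext l : 1
  induction l generalizing f with
  | nil => simp [conv, LinearMap.comp_assoc]
  | cons a l ih =>
    have h1 : (fun t => A.conv d' f g (A.twist d a :: t)) =
        (fun t => f [] ∘ₗ g (A.twist d a :: t)) +
          A.conv d' (fun t => f (A.twist (d' + d) a :: t)) g := by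
      ext t : 1
      rw [conv_cons, ← GrVect.twist_add]; rfl
    have h2 : A.conv d (fun t => f [] ∘ₗ g (A.twist d a :: t)) h l =
        f [] ∘ₗ A.conv d (fun t => g (A.twist d a :: t)) h l := by
      ext; simp [conv]
    rw [conv_cons, h1, conv_add_left, Pi.add_apply, ih, conv_cons, conv_cons, h2,
      LinearMap.comp_add, ← add_assoc]
    simp [conv, LinearMap.comp_assoc]

/-- The bar differential is a coderivation. -/
lemma barD_conv (d : Γ) {f : List A.carrier → N →ₗ[K] P} (hf : IsMultilin K f)
    (g : List A.carrier → M →ₗ[K] N) :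
    A.barD (A.conv d f g) =
      sgn d • A.conv d (A.barD f) g + A.conv (d + oneDeg Γ) f (A.barD g) := by
  have key : ∀ {f : List A.carrier → N →ₗ[K] P}, IsMultilin K f → ∀ L : List A.carrier,
      ∑ k ∈ range (L.length + 1),
        A.conv d (fun t => f (A.twist d (A.μ (L.take k)) :: t)) g (L.drop k) =
      sgn d • A.conv d
        (fun t => ∑ k ∈ range (t.length + 1), f (A.μ (t.take k) :: t.drop k)) g L := by
    intro f hf L
    have hu : ∀ (x : A.carrier) t, f ((sgn d • x) :: t) = sgn d • f (x :: t) :=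
      fun x t => hf.units [] t (sgn d) x
    have hs : ∀ (s : Finset ℕ) (F : ℕ → N →ₗ[K] P) (G : M →ₗ[K] N),
        (∑ i ∈ s, F i) ∘ₗ G = ∑ i ∈ s, F i ∘ₗ G := fun s F G => by
      ext x; simp
    simp only [conv, hs, smul_sum]
    rw [sum_sigma', sum_sigma']
    refine sum_nbij' (fun p => ⟨p.1 + p.2, p.1⟩) (fun p => ⟨p.2, p.1 - p.2⟩) ?_ ?_ ?_ ?_ ?_
    · rintro ⟨k, j⟩ h
      simp at h ⊢; omega
    · rintro ⟨k, j⟩ h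
      simp at h ⊢; omega
    · rintro ⟨k, j⟩ h
      simp
    · rintro ⟨k, j⟩ h
      simp at h ⊢; omega
    · rintro ⟨k, j⟩ h
      simp only [← List.map_take, ← List.map_drop, List.take_take, List.drop_take, List.drop_drop,
        μ_twist, min_eq_left (Nat.le_add_right k j), Nat.add_sub_cancel_left, hu,
        LinearMap.smul_comp, ← mul_smul, Int.units_mul_self, one_smul]
  ext l : 1
  induction l generalizing f with
  | nil =>
    have h1 := key hf []
    simp only [List.length_nil, zero_add, sum_range_one, List.take_nil, List.drop_nil] at h1
    simp only [barD, GrVect.insertOp_nil, Pi.add_apply, Pi.smul_apply]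
    rw [conv_cons, h1, add_comm]
    simp [conv, GrVect.insertOp_nil]
  | cons a l ih =>
    have h1 : (fun t => A.conv d f g (A.twist (oneDeg Γ) a :: t)) =
        (fun t => f [] ∘ₗ g (A.twist (oneDeg Γ) a :: t)) +
          A.conv d (fun t => f (A.twist (d + oneDeg Γ) a :: t)) g := by
      ext t : 1
      rw [conv_cons, ← GrVect.twist_add]; rfl
    have h2 : A.insertOp A.μ (fun t => f [] ∘ₗ g (A.twist (oneDeg Γ) a :: t)) l =
        f [] ∘ₗ A.insertOp A.μ (fun t => g (A.twist (oneDeg Γ) a :: t)) l := by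
      ext; simp [GrVect.insertOp]
    have h3 : (fun t => A.barD f (A.twist d a :: t)) =
        A.barD (fun t => f (A.twist (d + oneDeg Γ) a :: t)) +
        (fun t => ∑ k ∈ range (t.length + 2),
          f (A.μ ((A.twist d a :: t).take k) :: (A.twist d a :: t).drop k)) := by
      ext t : 1
      rw [barD, GrVect.insertOp_cons, ← GrVect.twist_add, add_comm (oneDeg Γ)]; rfl
    have h4 := key hf (a :: l)
    rw [conv_cons] at h4
    simp only [List.length_cons, add_assoc, Nat.reduceAdd] at h4
    have h5 : ∑ k ∈ range (l.length + 2), A.conv d f g (A.μ ((a :: l).take k) :: (a :: l).drop k) =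
        f [] ∘ₗ (∑ k ∈ range (l.length + 2), g (A.μ ((a :: l).take k) :: (a :: l).drop k)) +
        ∑ k ∈ range (l.length + 2),
          A.conv d (fun t => f (A.twist d (A.μ ((a :: l).take k)) :: t)) g ((a :: l).drop k) := by
      simp only [conv_cons, sum_add_distrib]
      congr 1
      ext; simp
    have ih' := ih (hf.cons (A.twist (d + oneDeg Γ) a))
    simp only [Pi.add_apply, Pi.smul_apply] at ih' ⊢
    change A.insertOp A.μ _ _ = _ at ih'
    rw [barD, GrVect.insertOp_cons, h1, GrVect.insertOp_add, Pi.add_apply, ih', h5, h4, conv_cons, conv_cons,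
      h3, conv_add_left, h2]
    simp only [barD, GrVect.insertOp_cons, GrVect.insertOp_nil, Pi.add_apply, smul_add,
      LinearMap.comp_add, List.length_nil, zero_add, sum_range_one, List.take_nil, List.drop_nil]
    abel

end Conv

end AInfAlgebra

end Lemmas

namespace AInfModule

variable {A : AInfAlgebra.{u, v, w} K Γ}

/-- The morphisms of degree `d` from `M` to `N` in the DG category of `A∞`-modules: the
strictly unital linear maps `BA ⊗ M → N` of degree `d`. -/
def Hom (M N : AInfModule A) (d : Γ) :
    Submodule K (List A.carrier → M.carrier →ₗ[K] N.carrier) where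
  carrier := {φ | IsMultilin K φ ∧
    (∀ (l : List A.carrier) (gs : List Γ), A.HasSuspDegrees l gs →
      ∀ (h : Γ) (m : M.carrier), m ∈ M.deg h → φ l m ∈ N.deg (gs.sum + h + d)) ∧
    (∀ l l' : List A.carrier, φ (l ++ A.e :: l') = 0)}
  add_mem' := by
    rintro φ ψ ⟨h1, h2, h3⟩ ⟨k1, k2, k3⟩
    refine ⟨⟨fun l l' a b => ?_, fun l l' c a => ?_⟩, fun l gs h g m hm => ?_, fun l l' => ?_⟩
    · simp only [Pi.add_apply, h1.1, k1.1]; abel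
    · simp only [Pi.add_apply, h1.2, k1.2, smul_add]
    · exact add_mem (h2 l gs h g m hm) (k2 l gs h g m hm)
    · simp only [Pi.add_apply, h3, k3, add_zero]
  zero_mem' := by
    refine ⟨⟨fun l l' a b => ?_, fun l l' c a => ?_⟩, fun l gs h g m hm => ?_, fun l l' => ?_⟩ <;>
      simp
  smul_mem' := by
    rintro c φ ⟨h1, h2, h3⟩
    refine ⟨⟨fun l l' a b => ?_, fun l l' c a => ?_⟩, fun l gs h g m hm => ?_, fun l l' => ?_⟩
    · simp only [Pi.smul_apply, h1.1, smul_add]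
    · simp only [Pi.smul_apply, h1.2, smul_comm c]
    · exact Submodule.smul_mem _ _ (h2 l gs h g m hm)
    · simp only [Pi.smul_apply, h3, smul_zero]

/-- The differential on morphisms of degree `d`:
`∂φ = φ ∘ (1 ⊗ μ_M) ∘ Δ + φ ∘ (b_A ⊗ 1) - (-1)^d μ_N ∘ (1 ⊗ φ) ∘ Δ`. -/
def diff (M N : AInfModule A) (d : Γ) :
    (List A.carrier → M.carrier →ₗ[K] N.carrier) →ₗ[K]
      (List A.carrier → M.carrier →ₗ[K] N.carrier) where
  toFun φ := A.conv (oneDeg Γ) φ M.μ + A.barD φ - sgn d • A.conv d N.μ φ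
  map_add' φ ψ := by
    rw [A.conv_add_left, A.conv_add_right, A.barD_add, smul_add]; abel
  map_smul' c φ := by
    rw [A.conv_smul_left, A.conv_smul_right, A.barD_smul, RingHom.id_apply, units_smul_smul,
      smul_sub, smul_add]

/-- Closed morphisms ("homomorphisms") of degree `d`. -/
def cocycles (M N : AInfModule A) (d : Γ) :
    Submodule K (List A.carrier → M.carrier →ₗ[K] N.carrier) :=
  M.Hom N d ⊓ LinearMap.ker (M.diff N d)

/-- The differentials of the morphisms of degree `d - 1`. -/
def boundaries (M N : AInfModule A) (d : Γ) :
    Submodule K (List A.carrier → M.carrier →ₗ[K] N.carrier) :=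
  (M.Hom N (d - oneDeg Γ)).map (M.diff N (d - oneDeg Γ))

/-- The space of morphisms of degree `d` from `M` to `N` in the graded cohomology category. -/
abbrev H (M N : AInfModule A) (d : Γ) : Type _ :=
  M.cocycles N d ⧸ (M.boundaries N d).submoduleOf (M.cocycles N d)

/-- The cohomology class of a closed morphism. -/
abbrev cls (M N : AInfModule A) (d : Γ) : M.cocycles N d →ₗ[K] M.H N d :=
  ((M.boundaries N d).submoduleOf (M.cocycles N d)).mkQ

lemma conv_mem_Hom {M N P : AInfModule A} {d₁ d₂ : Γ}
    {φ : List A.carrier → M.carrier →ₗ[K] N.carrier}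
    {ψ : List A.carrier → N.carrier →ₗ[K] P.carrier}
    (hφ : φ ∈ M.Hom N d₁) (hψ : ψ ∈ N.Hom P d₂) : A.conv d₁ ψ φ ∈ M.Hom P (d₁ + d₂) := by
  obtain ⟨h1, h2, h3⟩ := hφ
  obtain ⟨k1, k2, k3⟩ := hψ
  refine ⟨A.conv_isMultilin _ k1 h1, fun l gs hl h m hm => ?_, A.conv_unital _ k1 k3 h3⟩
  rw [AInfAlgebra.conv, LinearMap.sum_apply]
  refine Submodule.sum_mem _ fun i _ => ?_
  have hd := h2 (l.drop i) (gs.drop i) (List.forall₂_drop i hl) h m hm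
  have ht := k2 _ _ (GrVect.HasSuspDegrees.twist (List.forall₂_take i hl) d₁) _ _ hd
  have : (gs.take i).sum + ((gs.drop i).sum + h + d₁) + d₂ = gs.sum + h + (d₁ + d₂) := by
    rw [← List.sum_take_add_sum_drop gs i]; abel
  rwa [this] at ht

/-- The Leibniz rule. -/
lemma diff_conv {M N P : AInfModule A} (d₁ d₂ : Γ)
    (φ : List A.carrier → M.carrier →ₗ[K] N.carrier)
    {ψ : List A.carrier → N.carrier →ₗ[K] P.carrier} (hψ : IsMultilin K ψ) :
    M.diff P (d₁ + d₂) (A.conv d₁ ψ φ) =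
      A.conv (d₁ + oneDeg Γ) ψ (M.diff N d₁ φ) + sgn d₁ • A.conv d₁ (N.diff P d₂ ψ) φ := by
  have hl : ∀ (ε : ℤˣ) (f : List A.carrier → N.carrier →ₗ[K] P.carrier),
      A.conv d₁ (ε • f) φ = ε • A.conv d₁ f φ := fun ε f =>
    units_map_smul ((A.convₗ (N := N.carrier) (P := P.carrier) d₁).flip φ).toAddMonoidHom ε f
  have hr : ∀ (ε : ℤˣ) (f : List A.carrier → M.carrier →ₗ[K] N.carrier),
      A.conv (d₁ + oneDeg Γ) ψ (ε • f) = ε • A.conv (d₁ + oneDeg Γ) ψ f := fun ε f =>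
    units_map_smul (A.convₗ (M := M.carrier) (d₁ + oneDeg Γ) ψ).toAddMonoidHom ε f
  have el : ∀ f f' : List A.carrier → N.carrier →ₗ[K] P.carrier,
      A.conv d₁ (f - f') φ = A.conv d₁ f φ - A.conv d₁ f' φ := fun f f' =>
    map_sub ((A.convₗ (N := N.carrier) (P := P.carrier) d₁).flip φ) f f'
  have er : ∀ f f' : List A.carrier → M.carrier →ₗ[K] N.carrier,
      A.conv (d₁ + oneDeg Γ) ψ (f - f') = A.conv (d₁ + oneDeg Γ) ψ f - A.conv (d₁ + oneDeg Γ) ψ f' :=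
    fun f f' => map_sub (A.convₗ (M := M.carrier) (d₁ + oneDeg Γ) ψ) f f'
  simp only [diff, LinearMap.coe_mk, AddHom.coe_mk]
  rw [A.barD_conv d₁ hψ, A.conv_assoc, el, er, A.conv_add_left, A.conv_add_right, hl, hr,
    A.conv_assoc, A.conv_assoc, smul_sub, smul_add, sgn_add, mul_smul, add_comm d₂ d₁,
    add_comm (oneDeg Γ) d₁]
  abel

/-- Composition of closed morphisms, `ψ φ = ψ ∘ (1 ⊗ φ) ∘ Δ`. -/
def compZ (M N P : AInfModule A) {d₁ d₂ d : Γ} (h : d₁ + d₂ = d) :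
    N.cocycles P d₂ →ₗ[K] M.cocycles N d₁ →ₗ[K] M.cocycles P d :=
  LinearMap.mk₂ K
    (fun ψ φ => ⟨A.conv d₁ ψ.1 φ.1, by
      subst h
      refine ⟨conv_mem_Hom φ.2.1 ψ.2.1, ?_⟩
      have h1 : M.diff N d₁ φ.1 = 0 := φ.2.2
      have h2 : N.diff P d₂ ψ.1 = 0 := ψ.2.2
      show M.diff P (d₁ + d₂) (A.conv d₁ ψ.1 φ.1) = 0
      rw [diff_conv d₁ d₂ φ.1 ψ.2.1.1, h1, h2, ← A.convₗ_apply,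
        ← A.convₗ_apply, map_zero, map_zero, LinearMap.zero_apply, smul_zero, add_zero]⟩)
    (fun _ _ _ => Subtype.ext (A.conv_add_left _ _ _ _))
    (fun _ _ _ => Subtype.ext (A.conv_smul_left _ _ _ _))
    (fun _ _ _ => Subtype.ext (A.conv_add_right _ _ _ _))
    (fun _ _ _ => Subtype.ext (A.conv_smul_right _ _ _ _))

lemma compZ_boundary_right {M N P : AInfModule A} {d₁ d₂ d : Γ} (h : d₁ + d₂ = d)
    (ψ : N.cocycles P d₂) (φ : M.cocycles N d₁) (hφ : φ.1 ∈ M.boundaries N d₁) :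
    (compZ M N P h ψ φ).1 ∈ M.boundaries P d := by
  subst h
  obtain ⟨χ, hχ, hd⟩ := hφ
  have e : d₁ - oneDeg Γ + d₂ = d₁ + d₂ - oneDeg Γ := by abel
  have h2 : N.diff P d₂ ψ.1 = 0 := ψ.2.2
  have L := diff_conv (d₁ - oneDeg Γ) d₂ χ ψ.2.1.1
  rw [hd, h2, ← A.convₗ_apply (d₁ - oneDeg Γ) 0, map_zero, LinearMap.zero_apply, smul_zero, add_zero,
    sub_add_cancel, e] at L
  exact ⟨_, e ▸ conv_mem_Hom hχ ψ.2.1, L⟩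

lemma compZ_boundary_left {M N P : AInfModule A} {d₁ d₂ d : Γ} (h : d₁ + d₂ = d)
    (ψ : N.cocycles P d₂) (φ : M.cocycles N d₁) (hψ : ψ.1 ∈ N.boundaries P d₂) :
    (compZ M N P h ψ φ).1 ∈ M.boundaries P d := by
  subst h
  obtain ⟨χ, hχ, hd⟩ := hψ
  have e : d₁ + (d₂ - oneDeg Γ) = d₁ + d₂ - oneDeg Γ := by abel
  have h1 : M.diff N d₁ φ.1 = 0 := φ.2.2
  have L := diff_conv d₁ (d₂ - oneDeg Γ) φ.1 hχ.1
  rw [hd, h1, ← A.convₗ_apply (d₁ + oneDeg Γ), map_zero, zero_add, e] at L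
  refine ⟨sgn d₁ • A.conv d₁ χ φ.1, units_smul_mem _ _ (e ▸ conv_mem_Hom φ.2.1 hχ), ?_⟩
  have := units_map_smul (M.diff P (d₁ + d₂ - oneDeg Γ)).toAddMonoidHom (sgn d₁) (A.conv d₁ χ φ.1)
  refine this.trans ?_
  show sgn d₁ • M.diff P (d₁ + d₂ - oneDeg Γ) (A.conv d₁ χ φ.1) = _
  rw [L, ← mul_smul, Int.units_mul_self, one_smul]
  rfl

/-- Composition in the graded cohomology category: `[ψ] [φ] = [ψ φ]`, for `φ : M → N` of degree
`d₁` and `ψ : N → P` of degree `d₂`. -/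
def comp (M N P : AInfModule A) {d₁ d₂ d : Γ} (h : d₁ + d₂ = d) :
    N.H P d₂ →ₗ[K] M.H N d₁ →ₗ[K] M.H P d :=
  Submodule.liftQ _
    (LinearMap.flip (Submodule.liftQ _ (LinearMap.flip
        (LinearMap.compr₂ (compZ M N P h) (M.cls P d)))
      (fun φ hφ => by
        ext ψ
        exact (Submodule.Quotient.mk_eq_zero _).2 (compZ_boundary_right h ψ φ hφ))))
    (fun ψ hψ => by
      refine LinearMap.ext fun y => ?_
      obtain ⟨φ, rfl⟩ := Submodule.Quotient.mk_surjective _ y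
      exact (Submodule.Quotient.mk_eq_zero _).2 (compZ_boundary_left h ψ φ hψ))

lemma comp_cls (M N P : AInfModule A) {d₁ d₂ d : Γ} (h : d₁ + d₂ = d)
    (ψ : N.cocycles P d₂) (φ : M.cocycles N d₁) :
    comp M N P h (N.cls P d₂ ψ) (M.cls N d₁ φ) = M.cls P d (compZ M N P h ψ φ) := rfl

end AInfModule

lemma GrVect.insertOp_concat (V : GrVect.{u, v, w} K Γ) (μ : List V.carrier → V.carrier)
    {W : Type*} [AddCommGroup W] (f : List V.carrier → W) (l : List V.carrier) (x : V.carrier) :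
    V.insertOp μ f (l ++ [x]) = V.insertOp μ (fun t => f (t ++ [x])) l +
      ∑ i ∈ range (l.length + 1),
        f ((l.take i).map (V.twist (oneDeg Γ)) ++ [μ (l.drop i ++ [x])]) +
      f ((l ++ [x]).map (V.twist (oneDeg Γ)) ++ [μ []]) := by
  induction l generalizing f with
  | nil =>
    simp [insertOp_cons, insertOp_nil, sum_range_succ]
    abel
  | cons a l ih =>
    rw [List.cons_append, insertOp_cons, ih, insertOp_cons, List.length_append, List.length_cons,
      List.length_cons, List.length_nil, sum_range_succ _ (l.length + (0 + 1) + 1)]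
    have h1 : ∑ k ∈ range (l.length + (0 + 1) + 1),
        f (μ ((a :: (l ++ [x])).take k) :: (a :: (l ++ [x])).drop k) =
        ∑ k ∈ range (l.length + 2), f (μ ((a :: l).take k) :: (a :: l).drop k ++ [x]) := by
      refine sum_congr rfl fun k hk => ?_
      have hk' : k ≤ (a :: l).length := by simp at hk ⊢; omega
      rw [← List.cons_append, List.take_append_of_le_length hk', List.drop_append_of_le_length hk']
      rfl
    have h2 := sum_range_succ' (fun i =>
      f (((a :: l).take i).map (V.twist (oneDeg Γ)) ++ [μ ((a :: l).drop i ++ [x])])) (l.length + 1)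
    have h3 : (l ++ [x]).take (l.length + 1) = l ++ [x] := List.take_of_length_le (by simp)
    rw [h1, h2]
    simp [h3]
    abel

namespace AInfModule

variable {A : AInfAlgebra.{u, v, w} K Γ}

/-- The algebra `A` as a left module over itself, with structure maps
`(a₁ ⊗ ⋯ ⊗ aₙ) ⊗ a ↦ μⁿ⁺¹(a₁ ⊗ ⋯ ⊗ aₙ ⊗ a)`, where the last factor `a` is graded as in `A`.
(The module relation does not involve the degrees of module elements; inserting the sign
`(-1)^{|a₁| + ⋯ + |aₙ| + 1}` gives a module that is strictly isomorphic to this one by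
`a ↦ (-1)^{|a|} a`.) -/
def self (A : AInfAlgebra.{u, v, w} K Γ) : AInfModule A where
  toGrVect := A.toGrVect
  μ l :=
    { toFun := fun x => A.μ (l ++ [x])
      map_add' := fun x y => A.multilin.1 l [] x y
      map_smul' := fun c x => A.multilin.2 l [] c x }
  multilin := by
    refine ⟨fun l l' a b => LinearMap.ext fun x => ?_, fun l l' c a => LinearMap.ext fun x => ?_⟩
    · simpa using A.multilin.1 l (l' ++ [x]) a b
    · simpa using A.multilin.2 l (l' ++ [x]) c a
  degree l gs hl h m hm := by
    have := A.degree (l ++ [m]) (gs ++ [h - oneDeg Γ])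
      (List.rel_append hl (List.Forall₂.cons (by simpa using hm) List.Forall₂.nil))
    have e : (gs ++ [h - oneDeg Γ]).sum + oneDeg Γ + oneDeg Γ = gs.sum + h + oneDeg Γ := by
      simp only [List.sum_append, List.sum_singleton]; abel
    rwa [e] at this
  relation l := by
    ext x
    have h := A.relation (l ++ [x])
    rw [GrVect.insertOp_concat, A.μ_nil, A.multilin.zero, add_zero, add_comm] at h
    rw [LinearMap.zero_apply, ← h, LinearMap.add_apply]
    congr 1
    · simp [AInfAlgebra.conv]
    · simp [GrVect.insertOp]
  unit_one := by
    ext x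
    exact A.unit_left x
  unit_zero l l' h := by
    ext x
    have := A.unit_zero l (l' ++ [x]) (by simp; omega)
    simpa using this

/-- The ghost ideal: the classes `x : M → N` in the graded cohomology category that are sent to
zero by `Hom(A, -)`, that is, `x y = 0` for every class `y : A → M` of any degree. -/
def ghost (M N : AInfModule A) (d : Γ) : Submodule K (M.H N d) where
  carrier := {x | ∀ (c : Γ) (y : (self A).H M c), comp (self A) M N rfl x y = 0}
  add_mem' hx hy c y := by rw [map_add, LinearMap.add_apply, hx, hy, add_zero]
  zero_mem' c y := by rw [map_zero, LinearMap.zero_apply]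
  smul_mem' k x hx c y := by rw [map_smul, LinearMap.smul_apply, hx, smul_zero]

/-- The powers of the ghost ideal: `𝒢⁰` consists of all morphisms and `𝒢ʳ⁺¹ = 𝒢ʳ 𝒢` consists of
the sums of composites `x y` with `y : M → L` in `𝒢` and `x : L → N` in `𝒢ʳ`. -/
def ghostPow : ℕ → (M N : AInfModule A) → (d : Γ) → Submodule K (M.H N d)
  | 0, _, _, _ => ⊤
  | r + 1, M, N, d => Submodule.span K
      {z | ∃ (L : AInfModule A) (d₁ d₂ : Γ) (h : d₁ + d₂ = d),
        ∃ y ∈ ghost M L d₁, ∃ x ∈ ghostPow r L N d₂, z = comp M L N h x y}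

/-- The length filtration `𝓕ʳ` on morphisms: those that vanish on `(sA)^{⊗n} ⊗ M` for `n < r`. -/
def lengthFiltration (r : ℕ) (M N : AInfModule A) :
    Submodule K (List A.carrier → M.carrier →ₗ[K] N.carrier) where
  carrier := {φ | ∀ l : List A.carrier, l.length < r → φ l = 0}
  add_mem' hx hy l hl := by rw [Pi.add_apply, hx l hl, hy l hl, add_zero]
  zero_mem' _ _ := rfl
  smul_mem' c x hx l hl := by rw [Pi.smul_apply, hx l hl, smul_zero]

/-- The filtration `Fʳ` induced on cohomology: the classes that are represented by a closed
morphism in `𝓕ʳ`. -/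
def F (r : ℕ) (M N : AInfModule A) (d : Γ) : Submodule K (M.H N d) :=
  ((lengthFiltration r M N).submoduleOf (M.cocycles N d)).map (M.cls N d)

end AInfModule

end

noncomputable section

open Finset

set_option linter.unusedSectionVars false

variable {K : Type u} [Field K] {Γ : Type w} [AddCommGroup Γ] [DecidableEq Γ] [GradingGroup Γ]

/-! The case `r = 1` identifies ghosts with classes that have a representative vanishing on words of
length zero; a cone construction then peels one letter at a time off a cocycle.

Closed morphisms out of `A` are controlled by the unit. If `z : A → N` is closed with `z [] = 0`,
then inserting `e` as the module argument, `l ⊗ a ↦ ± z (l ⊗ a) e`, gives a primitive of `z`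
(`mem_boundaries_of_nil_eq_zero`). A cocycle with zero length-zero part keeps this property after
composition with any `A → M`, so it is a ghost (`F_one_le_ghost`). Conversely, every cycle `m` of
`M` defines a closed morphism `l ⊗ a ↦ ± μ_M (l ⊗ a) m` from `A` to `M`, so a ghost sends cycles to
boundaries in length zero. Over a field its length-zero part is then null-homotopic as a map of
complexes. Extending the homotopy by zero to longer words and subtracting its differential gives a
representative in the first filtration step (`ghost_le_F_one`).

Composition adds word lengths, so the `r`-th power of the ghost ideal lies in `F r`. For the other
inclusion, let `C = M ⊕ (sA ⊗ M)` be the cone of the action on `M` of the free module on the complex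
`M`. The inclusion `M → C` is a ghost, because `m ↦ e ⊗ m` contracts it in length zero. A cocycle
`φ` with `φ [] = 0` extends to `C` by `l ⊗ (a ⊗ m) ↦ φ (l ⊗ a) m`, which lowers the filtration by
exactly one (`F_succ_le`). Induction on `r` finishes the proof. -/

lemma sgn_zero : sgn (0 : Γ) = 1 := by
  simp [sgn]

lemma sgn_neg (d : Γ) : sgn (-d) = sgn d := by
  have h : sgn (-d) * sgn d = 1 := by rw [← sgn_add, neg_add_cancel, sgn_zero]
  rw [mul_eq_one_iff_eq_inv.1 h, Int.units_inv_eq_self]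

lemma sgn_sub_oneDeg (d : Γ) : sgn (d - oneDeg Γ) = -sgn d := by
  rw [sub_eq_add_neg, sgn_add, sgn_neg, sgn_oneDeg, mul_neg_one]

lemma koszul_neg_oneDeg_right (d : Γ) : koszul d (0 - oneDeg Γ) = sgn d := by
  have h : koszul d (0 - oneDeg Γ) * sgn d = 1 := by
    rw [← koszul_oneDeg_right, ← koszul_add_right, sub_add_cancel, koszul_zero_right]
  rw [mul_eq_one_iff_eq_inv.1 h, Int.units_inv_eq_self]

/-! ### Sign twists, and maps concentrated in word length zero. -/

lemma GrVect.twist_zero (V : GrVect.{u, v, w} K Γ) : V.twist 0 = LinearMap.id := by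
  ext a
  refine V.induction_hom (P := fun a => V.twist 0 a = a) a (fun g x hx => ?_) (map_zero _)
    (fun x y hx hy => by simp only [map_add, hx, hy])
  rw [V.twist_of_susp _ hx]
  simp [koszul]

lemma GrVect.map_twist_twist (V : GrVect.{u, v, w} K Γ) (d d' : Γ) (l : List V.carrier) :
    (l.map (V.twist d')).map (V.twist d) = l.map (V.twist (d + d')) := by
  rw [List.map_map]
  exact List.map_congr_left fun a _ => (V.twist_add d d' a).symm

namespace AInfAlgebra

variable (A : AInfAlgebra.{u, v, w} K Γ)

/-- The unit has degree `0` in `A`, hence degree `-1` in `sA`. -/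
lemma twist_e_eq (d : Γ) : A.twist d A.e = sgn d • A.e := by
  rw [twist_e, koszul_neg_oneDeg_right]

lemma μ_unit_right (a : A.carrier) : A.μ [a, A.e] = -A.twist (oneDeg Γ) a := by
  have hadd := fun x y => A.multilin.1 [] [A.e] x y
  refine A.induction_hom (P := fun a => A.μ [a, A.e] = -A.twist (oneDeg Γ) a) a
    (fun g x hx => ?_) ?_ (fun x y hx hy => ?_)
  · rw [A.unit_right g x hx, A.twist_of_susp _ hx]
    rw [koszul, mul_comm, ← koszul, koszul_oneDeg_right]
  · rw [map_zero, neg_zero]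
    exact A.multilin.zero [] [A.e]
  · simp only [List.nil_append] at hadd
    rw [hadd, hx, hy, map_add, neg_add]

lemma barD_concat {W : Type*} [AddCommGroup W] [Module K W] {f : List A.carrier → W}
    (hf : IsMultilin K f) (l : List A.carrier) (x : A.carrier) :
    A.barD f (l ++ [x]) = A.barD (fun t => f (t ++ [x])) l +
      ∑ i ∈ range (l.length + 1),
        f ((l.take i).map (A.twist (oneDeg Γ)) ++ [A.μ (l.drop i ++ [x])]) := by
  rw [barD, GrVect.insertOp_concat, A.μ_nil, hf.zero, add_zero]

section Strict

variable {M N P : Type*} [AddCommGroup M] [Module K M] [AddCommGroup N] [Module K N]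
  [AddCommGroup P] [Module K P]

lemma conv_concat (d : Γ) (f : List A.carrier → N →ₗ[K] P) (g : List A.carrier → M →ₗ[K] N)
    (l : List A.carrier) (a : A.carrier) :
    A.conv d f g (l ++ [a]) =
      ∑ i ∈ range (l.length + 1), f ((l.take i).map (A.twist d)) ∘ₗ g (l.drop i ++ [a]) +
      f ((l ++ [a]).map (A.twist d)) ∘ₗ g [] := by
  rw [conv_split]
  simp [conv]

/-- The map `BA ⊗ M → N` that is `h` on `M` and zero on `(sA)^{⊗n} ⊗ M` for `n > 0`. -/
def strict (h : M →ₗ[K] N) : List A.carrier → M →ₗ[K] N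
  | [] => h
  | _ :: _ => 0

@[simp] lemma strict_nil (h : M →ₗ[K] N) : A.strict h [] = h := rfl

@[simp] lemma strict_cons (h : M →ₗ[K] N) (a : A.carrier) (l : List A.carrier) :
    A.strict h (a :: l) = 0 := rfl

@[simp] lemma strict_append_cons (h : M →ₗ[K] N) (l : List A.carrier) (a : A.carrier)
    (l' : List A.carrier) : A.strict h (l ++ a :: l') = 0 := by
  cases l <;> rfl

lemma strict_isMultilin (h : M →ₗ[K] N) : IsMultilin K (A.strict h) :=
  ⟨fun _ _ _ _ => by simp, fun _ _ _ _ => by simp⟩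

lemma barD_strict (h : M →ₗ[K] N) : A.barD (A.strict h) = 0 := by
  ext l : 1
  simp [GrVect.insertOp]

lemma conv_strict_left (d : Γ) (h : N →ₗ[K] P) (g : List A.carrier → M →ₗ[K] N)
    (l : List A.carrier) : A.conv d (A.strict h) g l = h ∘ₗ g l := by
  cases l with
  | nil => simp [conv]
  | cons a l =>
    rw [conv_cons]
    simp [conv]

lemma conv_strict_right (d : Γ) (f : List A.carrier → N →ₗ[K] P) (h : M →ₗ[K] N)
    (l : List A.carrier) : A.conv d f (A.strict h) l = f (l.map (A.twist d)) ∘ₗ h := by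
  induction l generalizing f with
  | nil => simp [conv]
  | cons a l ih =>
    rw [conv_cons, ih]
    simp

end Strict

/-! ### The last letter of a word as a variable in the module `A`. -/

section Twist

variable {N : Type*} [AddCommGroup N] [Module K N]

/-- Each term of the bar differential contains one operation, and `μ` has degree `1`; moving the
twist past it costs one factor `sgn d`. -/
lemma barD_map_twist {W : Type*} [AddCommGroup W] [Module K W] {f : List A.carrier → W}
    (hf : IsMultilin K f) (d : Γ) (l : List A.carrier) :
    A.barD (fun t => f (t.map (A.twist d))) l = sgn d • A.barD f (l.map (A.twist d)) := by
  simp only [barD, GrVect.insertOp, smul_sum, List.length_map]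
  refine sum_congr rfl fun r _ => sum_congr rfl fun k _ => ?_
  rw [← hf.units, ← List.map_drop, ← List.map_take, ← List.map_take, ← List.map_drop, A.μ_twist,
    smul_smul, Int.units_mul_self, one_smul, List.map_append, List.map_cons,
    GrVect.map_twist_twist, GrVect.map_twist_twist, add_comm]

/-- The map `(a₁ ⊗ ⋯ ⊗ aₙ) ⊗ a ↦ f (a₁ ⊗ ⋯ ⊗ aₙ ⊗ a)` obtained from `f : BA → N`. -/
def splitLast {f : List A.carrier → N} (hf : IsMultilin K f) (l : List A.carrier) :
    A.carrier →ₗ[K] N where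
  toFun a := f (l ++ [a])
  map_add' a b := hf.1 l [] a b
  map_smul' c a := hf.2 l [] c a

@[simp] lemma splitLast_apply {f : List A.carrier → N} (hf : IsMultilin K f) (l : List A.carrier)
    (a : A.carrier) : A.splitLast hf l a = f (l ++ [a]) := rfl

lemma splitLast_isMultilin {f : List A.carrier → N} (hf : IsMultilin K f) :
    IsMultilin K (A.splitLast hf) := by
  refine ⟨fun l l' a b => LinearMap.ext fun x => ?_, fun l l' c a => LinearMap.ext fun x => ?_⟩
  · simpa using hf.1 l (l' ++ [x]) a b
  · simpa using hf.2 l (l' ++ [x]) c a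

end Twist

end AInfAlgebra

namespace AInfAlgebra

variable (A : AInfAlgebra.{u, v, w} K Γ)

lemma map_twist_append_unit {W : Type*} [AddCommGroup W] [Module K W] {f : List A.carrier → W}
    (hf : IsMultilin K f) (d : Γ) (l l' : List A.carrier) :
    f ((l ++ A.e :: l').map (A.twist d)) =
      sgn d • f (l.map (A.twist d) ++ A.e :: l'.map (A.twist d)) := by
  rw [List.map_append, List.map_cons, A.twist_e_eq, hf.units]

/-- The structure map of `A` as a left module over itself. -/
def selfOp : List A.carrier → A.carrier →ₗ[K] A.carrier := (AInfModule.self A).μ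

@[simp] lemma selfOp_apply (l : List A.carrier) (a : A.carrier) : A.selfOp l a = A.μ (l ++ [a]) :=
  rfl

section Slant

variable {M N P : Type*} [AddCommGroup M] [Module K M] [AddCommGroup N] [Module K N]
  [AddCommGroup P] [Module K P]

/-- The map `(a₁ ⊗ ⋯ ⊗ aₙ) ⊗ a ↦ ± φ (a₁ ⊗ ⋯ ⊗ aₙ ⊗ a ⊗ m)` with the sign
`(-1)^{d(|a₁| + ⋯ + |aₙ| + |a|)}`. -/
def slant {φ : List A.carrier → M →ₗ[K] N} (hφ : IsMultilin K φ) (m : M) (d : Γ) :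
    List A.carrier → A.carrier →ₗ[K] N :=
  A.splitLast ((hφ.comp_linear (LinearMap.applyₗ m)).comp_map (A.twist d))

variable {φ : List A.carrier → M →ₗ[K] N} (hφ : IsMultilin K φ) (m : M) (d : Γ)

@[simp] lemma slant_apply (l : List A.carrier) (a : A.carrier) :
    A.slant hφ m d l a = φ ((l ++ [a]).map (A.twist d)) m := rfl

lemma slant_isMultilin : IsMultilin K (A.slant hφ m d) := A.splitLast_isMultilin _

/-- On the word `l ++ [a]` the right-hand side has one splitting more than the left-hand side,
namely the one that leaves `φ` the empty word; `h0` removes it. The twist inside `slant` accounts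
for the change of degree from `c` to `c + d`. -/
lemma conv_slant (c : Γ) (f : List A.carrier → N →ₗ[K] P) (h0 : φ [] m = 0)
    (l : List A.carrier) (a : A.carrier) :
    A.conv (c + d) f (A.slant hφ m d) l a = A.conv c f φ ((l ++ [a]).map (A.twist d)) m := by
  rw [List.map_append, List.map_cons, List.map_nil, conv_concat]
  simp only [conv, LinearMap.add_apply, LinearMap.sum_apply, LinearMap.comp_apply, h0, map_zero,
    add_zero, slant_apply, List.length_map, ← List.map_take, ← List.map_drop,
    GrVect.map_twist_twist, List.map_append, List.map_cons, List.map_nil]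

/-- An operation in the bar differential of `l ++ [a]` either uses the last letter, and is then the
action of `A` on itself, or lies inside `l`. -/
lemma slant_conv_self (l : List A.carrier) (a : A.carrier) :
    A.conv (oneDeg Γ) (A.slant hφ m d) A.selfOp l a + A.barD (A.slant hφ m d) l a =
      sgn d • A.barD φ ((l ++ [a]).map (A.twist d)) m := by
  have hG := hφ.comp_linear (LinearMap.applyₗ (R := K) (M₂ := N) m)
  have h1 := A.barD_map_twist hG d (l ++ [a])
  rw [A.barD_concat (hG.comp_map _)] at h1
  have h2 : A.barD (fun t => (LinearMap.applyₗ (R := K) (M₂ := N) m) (φ t))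
      ((l ++ [a]).map (A.twist d)) = A.barD φ ((l ++ [a]).map (A.twist d)) m := by
    simp [GrVect.insertOp]
  rw [← h2, ← h1, add_comm]
  congr 1
  · simp [GrVect.insertOp]
  · simp [conv]

end Slant

end AInfAlgebra

/-! ### Closed morphisms out of `A`. -/

namespace AInfModule

variable {A : AInfAlgebra.{u, v, w} K Γ}

lemma slant_mem_Hom {M : Type*} [AddCommGroup M] [Module K M] {N : AInfModule A}
    {φ : List A.carrier → M →ₗ[K] N.carrier} (hφ : IsMultilin K φ) (m : M) (c d k : Γ)
    (hdeg : ∀ (l : List A.carrier) (gs : List Γ), A.HasSuspDegrees l gs →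
      φ l m ∈ N.deg (gs.sum + k))
    (hunit : ∀ l l' a, φ (l ++ A.e :: (l' ++ [a])) m = 0) (hk : k - oneDeg Γ = c) :
    A.slant hφ m d ∈ (self A).Hom N c := by
  refine ⟨A.slant_isMultilin hφ m d, fun l gs hl g (a : A.carrier) (ha : a ∈ A.deg g) => ?_,
    fun l l' => LinearMap.ext fun (a : A.carrier) => ?_⟩
  · have hla : A.HasSuspDegrees (l ++ [a]) (gs ++ [g - oneDeg Γ]) :=
      List.rel_append hl (List.Forall₂.cons (by rwa [sub_add_cancel]) List.Forall₂.nil)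
    have := hdeg _ _ (hla.twist d)
    have e : (gs ++ [g - oneDeg Γ]).sum + k = gs.sum + g + c := by
      rw [List.sum_append, List.sum_singleton, ← hk]; abel
    rwa [e] at this
  · have h := A.map_twist_append_unit
      (hφ.comp_linear (LinearMap.applyₗ (R := K) (M₂ := N.carrier) m)) d l (l' ++ [a])
    have h' : (l ++ A.e :: l') ++ [a] = l ++ A.e :: (l' ++ [a]) := by simp
    change φ (((l ++ A.e :: l') ++ [a]).map (A.twist d)) m = 0
    rw [h']
    refine h.trans ?_
    rw [List.map_append]
    show sgn d • φ _ m = 0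
    rw [List.map_cons, List.map_nil, hunit, smul_zero]

/-- A cycle `m` of degree `c` in `M` is the image of the unit under a closed morphism `A → M`. -/
lemma slant_structure_mem_cocycles (M : AInfModule A) {c : Γ} {m : M.carrier} (hm : m ∈ M.deg c)
    (h0 : M.μ [] m = 0) : A.slant M.multilin m (c - oneDeg Γ) ∈ (self A).cocycles M c := by
  refine ⟨slant_mem_Hom M.multilin m c _ (c + oneDeg Γ) (fun l gs hl => ?_) (fun l l' a => ?_)
    (add_sub_cancel_right _ _), funext fun l => LinearMap.ext fun (a : A.carrier) => ?_⟩
  · have := M.degree l gs hl c m hm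
    rwa [add_assoc] at this
  · rw [M.unit_zero _ _ (by simp), LinearMap.zero_apply]
  -- Closedness is the relation of `M` on the word `l ++ [a]` applied to `m`; the missing term, in
  -- which the action ends with `M.μ [] m`, is zero by `h0`.
  · have h1 := A.slant_conv_self M.multilin m (c - oneDeg Γ) l a
    have h2 := A.conv_slant M.multilin m (c - oneDeg Γ) (oneDeg Γ) M.μ h0 l a
    have h3 := LinearMap.congr_fun (M.relation ((l ++ [a]).map (A.twist (c - oneDeg Γ)))) m
    rw [LinearMap.add_apply, LinearMap.zero_apply, ← h2, add_sub_cancel] at h3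
    change A.conv (oneDeg Γ) _ A.selfOp l a + A.barD (A.slant M.multilin m _) l a -
      sgn c • A.conv c M.μ _ l a = 0
    rw [h1, sgn_sub_oneDeg, eq_neg_of_add_eq_zero_right h3, Units.neg_smul, smul_neg, neg_neg,
      sub_self]

/-- By strict unitality `A.e` is killed by every operation except the binary one, so only the
splitting with `[a]` on the right survives. -/
lemma conv_selfOp_unit {N : Type*} [AddCommGroup N] [Module K N] (d : Γ)
    (z : List A.carrier → A.carrier →ₗ[K] N) (l : List A.carrier) (a : A.carrier) :
    A.conv d z A.selfOp (l ++ [a]) A.e =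
      -z (l.map (A.twist d)) (A.twist (oneDeg Γ) a) := by
  have hnil : A.selfOp [] A.e = 0 := A.unit_zero [] [] (by simp)
  rw [A.conv_concat, LinearMap.add_apply, LinearMap.sum_apply, sum_range_succ, sum_eq_zero,
    zero_add, LinearMap.comp_apply, LinearMap.comp_apply, hnil, map_zero, add_zero,
    List.drop_length, List.take_length]
  · show z _ (A.μ [a, A.e]) = _
    rw [A.μ_unit_right, map_neg]
  · intro i hi
    have hi' := mem_range.1 hi
    rw [LinearMap.comp_apply, A.selfOp_apply, A.unit_zero _ [] (by simp; omega), map_zero]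

/-- A closed morphism `z : A → N` that vanishes on `A` is exact. -/
lemma mem_boundaries_of_nil_eq_zero {N : AInfModule A} {c : Γ}
    (z : List A.carrier → A.carrier →ₗ[K] N.carrier) (hz : z ∈ (self A).cocycles N c)
    (h0 : z [] = 0) : z ∈ (self A).boundaries N c := by
  obtain ⟨⟨hm, hdeg, hu⟩, hd⟩ := hz
  -- The primitive evaluates `z` on the longer word `l ++ [a]` at the unit. The twist by `-1`
  -- cancels the twist by `1` that `conv_selfOp_unit` produces, so the closedness of `z` at this
  -- word and `A.e` reads: `z l a` is the sum of the remaining terms.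
  have hw : -A.slant hm A.e (-oneDeg Γ) ∈ (self A).Hom N (c - oneDeg Γ) := by
    refine neg_mem (slant_mem_Hom hm A.e _ _ c (fun l gs hl => ?_) (fun l l' a => ?_) rfl)
    · have := hdeg l gs hl 0 A.e A.e_mem
      rwa [add_zero] at this
    · exact LinearMap.congr_fun (hu _ _) _
  refine ⟨-A.slant hm A.e (-oneDeg Γ), hw, ?_⟩
  refine (map_neg _ _).trans (neg_eq_iff_eq_neg.2 ?_)
  refine funext fun l => LinearMap.ext fun (a : A.carrier) => ?_
  have h1 := A.slant_conv_self hm A.e (-oneDeg Γ) l a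
  have h2 := A.conv_slant hm A.e (-oneDeg Γ) c N.μ (by rw [h0]; rfl) l a
  have h3 : A.conv (oneDeg Γ) z A.selfOp ((l ++ [a]).map (A.twist (-oneDeg Γ))) A.e +
      A.barD z ((l ++ [a]).map (A.twist (-oneDeg Γ))) A.e -
      sgn c • A.conv c N.μ z ((l ++ [a]).map (A.twist (-oneDeg Γ))) A.e = 0 :=
    LinearMap.congr_fun
      (congr_fun (LinearMap.mem_ker.1 hd) ((l ++ [a]).map (A.twist (-oneDeg Γ)))) A.e
  have h4 : A.conv (oneDeg Γ) z A.selfOp ((l ++ [a]).map (A.twist (-oneDeg Γ))) A.e =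
      -z l a := by
    rw [List.map_append, List.map_cons, List.map_nil, conv_selfOp_unit, GrVect.map_twist_twist,
      ← GrVect.twist_add, add_neg_cancel, GrVect.twist_zero]
    simp
  change A.conv (oneDeg Γ) _ A.selfOp l a + A.barD (A.slant hm A.e _) l a -
    sgn (c - oneDeg Γ) • A.conv (c - oneDeg Γ) N.μ _ l a = -z l a
  rw [← sub_eq_add_neg] at h2
  rw [h1, h2, sgn_neg, sgn_oneDeg, sgn_sub_oneDeg, Units.neg_smul, Units.neg_smul, one_smul,
    ← h4, ← sub_eq_zero, ← neg_eq_zero, ← h3]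
  abel

end AInfModule

/-! ### Splittings and null homotopies over a field. -/

lemma LinearMap.exists_generalized_inverse {V W : Type*} [AddCommGroup V] [Module K V]
    [AddCommGroup W] [Module K W] (f : V →ₗ[K] W) : ∃ p : W →ₗ[K] V, ∀ x, f (p (f x)) = f x := by
  -- A section over the image of `f`, extended arbitrarily to all of `W`.
  obtain ⟨r, hr⟩ := f.rangeRestrict.exists_rightInverse_of_surjective f.range_rangeRestrict
  obtain ⟨p, hp⟩ := r.exists_extend
  refine ⟨p, fun x => ?_⟩
  have h1 : p (f x) = r (f.rangeRestrict x) := LinearMap.congr_fun hp (f.rangeRestrict x)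
  have h2 := congr_arg Subtype.val (LinearMap.congr_fun hr (f.rangeRestrict x))
  rw [h1]
  exact h2

lemma GrVect.exists_graded_generalized_inverse (V : GrVect.{u, v, w} K Γ)
    (D : V.carrier →ₗ[K] V.carrier) (hD : ∀ h, ∀ x ∈ V.deg h, D x ∈ V.deg (h + oneDeg Γ)) :
    ∃ s : V.carrier →ₗ[K] V.carrier, (∀ h, ∀ x ∈ V.deg h, s x ∈ V.deg (h - oneDeg Γ)) ∧
      ∀ x, D (s (D x)) = D x := by
  have hD' : ∀ h, ∀ x ∈ V.deg (h - oneDeg Γ), D x ∈ V.deg h := fun h x hx => by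
    simpa using hD _ x hx
  -- Splitting each graded piece separately makes the assembled map homogeneous of degree `-1`.
  choose p hp using fun h => (D.restrict (hD' h)).exists_generalized_inverse
  let s : V.carrier →ₗ[K] V.carrier :=
    (DirectSum.toModule K Γ V.carrier fun h => (V.deg (h - oneDeg Γ)).subtype ∘ₗ p h) ∘ₗ
      V.decomp.symm.toLinearMap
  have hs : ∀ h (x : V.deg h), s x = p h x := fun h x => by
    have h1 : V.decomp.symm x = DirectSum.lof K Γ (fun i => V.deg i) h x := by
      rw [LinearEquiv.symm_apply_eq]
      exact (DirectSum.coeLinearMap_lof (A := V.deg) h x).symm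
    simp only [s, LinearMap.comp_apply, LinearEquiv.coe_coe, h1, DirectSum.toModule_lof]
    rfl
  refine ⟨s, fun h x hx => ?_, fun x => ?_⟩
  · rw [hs h ⟨x, hx⟩]
    exact (p h ⟨x, hx⟩).2
  · refine V.induction_hom (P := fun x => D (s (D x)) = D x) x (fun g x hx => ?_)
      (by simp only [map_zero]) (fun x y hx hy => by simp only [map_add, hx, hy])
    have hx' : x ∈ V.deg (g + oneDeg Γ + oneDeg Γ - oneDeg Γ) := by
      rwa [add_sub_cancel_right]
    rw [hs _ ⟨D x, hD _ x hx⟩]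
    exact congr_arg Subtype.val (hp (g + oneDeg Γ + oneDeg Γ) ⟨x, hx'⟩)

/-- The map `1 - s D` projects onto the cycles, and `hp` says that `p` provides primitives for the
values of `f` on cycles. With `h = ε p f (1 - s D) + f s - ε p f D s`, the composite `h D` is `f s
D` and `ε E h` is `f (1 - s D)`; the last term of `h` cancels the contribution of `E f s`. -/
lemma exists_homotopy {V W : Type*} [AddCommGroup V] [Module K V] [AddCommGroup W] [Module K W]
    {D s : V →ₗ[K] V} {E p : W →ₗ[K] W} {f : V →ₗ[K] W} (ε : ℤˣ) (hDD : ∀ x, D (D x) = 0)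
    (hfD : ∀ x, f (D x) = ε • E (f x)) (hs : ∀ x, D (s (D x)) = D x)
    (hp : ∀ x, E (p (f (x - s (D x)))) = f (x - s (D x))) (x : V) :
    f x = (ε • p (f (D x - s (D (D x)))) + f (s (D x)) - ε • p (f (D (s (D x))))) +
      ε • E (ε • p (f (x - s (D x))) + f (s x) - ε • p (f (D (s x)))) := by
  have hu : ∀ y : W, E (ε • y) = ε • E y := units_map_smul E.toAddMonoidHom ε
  -- A boundary is a cycle, so the projection fixes `D (s x)`.
  have h1 := hp (D (s x))
  simp only [hDD, map_zero, sub_zero] at h1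
  simp only [map_sub, map_add, smul_sub, smul_add, hu, smul_smul, Int.units_mul_self, one_smul,
    h1, ← hfD] at hp ⊢
  simp only [hs, hDD, map_zero, hp, smul_zero]
  abel

/-! ### Ghosts and the first step of the length filtration. -/

namespace AInfModule

variable {A : AInfAlgebra.{u, v, w} K Γ} {M N P : AInfModule A}

lemma structure_nil_mem (M : AInfModule A) {h : Γ} {m : M.carrier} (hm : m ∈ M.deg h) :
    M.μ [] m ∈ M.deg (h + oneDeg Γ) := by
  simpa using M.degree [] [] List.Forall₂.nil h m hm

lemma barD_nil {W : Type*} [AddCommGroup W] [Module K W] {f : List A.carrier → W}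
    (hf : IsMultilin K f) : A.barD f [] = 0 := by
  rw [AInfAlgebra.barD, GrVect.insertOp_nil, A.μ_nil]
  exact hf.zero [] []

lemma structure_nil_nil (M : AInfModule A) (m : M.carrier) : M.μ [] (M.μ [] m) = 0 := by
  have := LinearMap.congr_fun (M.relation []) m
  rw [LinearMap.add_apply, barD_nil (K := K) M.multilin] at this
  simpa [AInfAlgebra.conv] using this

lemma diff_nil {φ : List A.carrier → M.carrier →ₗ[K] N.carrier} (hφ : IsMultilin K φ) (d : Γ)
    (m : M.carrier) : M.diff N d φ [] m = φ [] (M.μ [] m) - sgn d • N.μ [] (φ [] m) := by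
  show (A.conv (oneDeg Γ) φ M.μ + A.barD φ - sgn d • A.conv d N.μ φ) [] m = _
  rw [Pi.sub_apply, Pi.add_apply, barD_nil hφ]
  simp [AInfAlgebra.conv]

lemma strict_mem_Hom {d : Γ} {h : M.carrier →ₗ[K] N.carrier}
    (hh : ∀ g, ∀ m ∈ M.deg g, h m ∈ N.deg (g + d)) : A.strict h ∈ M.Hom N d := by
  refine ⟨A.strict_isMultilin h, fun l gs hl g m hm => ?_, fun l l' => by simp⟩
  cases hl with
  | nil => simpa using hh g m hm
  | cons _ _ => exact zero_mem _

lemma diff_strict_apply (h : M.carrier →ₗ[K] N.carrier) (d : Γ) (l : List A.carrier) :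
    M.diff N d (A.strict h) l = h ∘ₗ M.μ l - sgn d • (N.μ (l.map (A.twist d)) ∘ₗ h) := by
  show A.conv (oneDeg Γ) (A.strict h) M.μ l + A.barD (A.strict h) l -
    sgn d • A.conv d N.μ (A.strict h) l = _
  rw [A.conv_strict_left, A.conv_strict_right, A.barD_strict, Pi.zero_apply, add_zero]

/-- `M.μ` is the identity on the unit, so it need not be a morphism in `M.Hom M`; but `diff` is
defined on all maps and `diff_conv` asks only for multilinearity, so this formula can be used in the
Leibniz rule. -/
lemma diff_structure (M : AInfModule A) :
    M.diff M (oneDeg Γ) M.μ = A.conv (oneDeg Γ) M.μ M.μ := by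
  show A.conv (oneDeg Γ) M.μ M.μ + A.barD M.μ - sgn (oneDeg Γ) • A.conv (oneDeg Γ) M.μ M.μ = _
  have : A.conv (oneDeg Γ) M.μ M.μ + A.barD M.μ = 0 := funext M.relation
  rw [this, sgn_oneDeg, Units.neg_smul, one_smul, zero_sub, neg_neg]

/-- Both unitality and closedness need an argument, since the structure maps do not vanish on the
unit. -/
lemma diff_strict_mem_cocycles {d d' : Γ} (hd : d' + oneDeg Γ = d) {h : M.carrier →ₗ[K] N.carrier}
    (hh : ∀ g, ∀ m ∈ M.deg g, h m ∈ N.deg (g + d')) :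
    M.diff N d' (A.strict h) ∈ M.cocycles N d := by
  subst hd
  refine ⟨⟨?_, fun l gs hl g m hm => ?_, fun l l' => ?_⟩, ?_⟩
  · have e : M.diff N d' (A.strict h) =
        fun l => h ∘ₗ M.μ l - sgn d' • (N.μ (l.map (A.twist d')) ∘ₗ h) :=
      funext fun l => diff_strict_apply h d' l
    rw [e]
    have h1 := M.multilin
    have h2 := N.multilin.comp_map (A.twist d')
    constructor
    · intro l l' a b
      simp only [h1.1, h2.1, LinearMap.comp_add, LinearMap.add_comp, smul_add]
      abel
    · intro l l' c a
      simp only [h1.2, h2.2, LinearMap.comp_smul, LinearMap.smul_comp, smul_sub,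
        units_smul_smul]
  · rw [diff_strict_apply]
    refine sub_mem ?_ (units_smul_mem _ _ ?_)
    · have := hh _ _ (M.degree l gs hl g m hm)
      rwa [add_assoc _ (oneDeg Γ), add_comm (oneDeg Γ)] at this
    · have := N.degree _ gs (hl.twist d') _ _ (hh g m hm)
      rwa [← add_assoc, add_assoc _ d'] at this
  · rw [diff_strict_apply, A.map_twist_append_unit N.multilin]
    by_cases hl : l.length + l'.length = 0
    · obtain ⟨rfl, rfl⟩ : l = [] ∧ l' = [] := by
        simpa using hl
      -- On the word `[A.e]` both structure maps are the identity, and the two copies of `h` cancel.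
      simp [M.unit_one, N.unit_one, smul_smul, LinearMap.smul_comp]
    · rw [M.unit_zero _ _ hl, N.unit_zero _ _ (by simpa using hl)]
      simp
  -- The differential of `A.strict h` is `X - sgn d' • Y`. The Leibniz rule for `X` and `Y`, with
  -- `diff_structure` for the two structure maps, makes all terms cancel.
  · set X := A.conv (oneDeg Γ) (A.strict h) M.μ
    set Y := A.conv d' N.μ (A.strict h)
    have e : M.diff N d' (A.strict h) = X - sgn d' • Y := by
      show X + A.barD (A.strict h) - sgn d' • Y = _
      rw [A.barD_strict, add_zero]
    have h1 := diff_conv (P := N) (oneDeg Γ) d' M.μ (A.strict_isMultilin h)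
    have h2 := diff_conv (M := M) (P := N) d' (oneDeg Γ) (A.strict h) N.multilin
    have hX : A.conv (oneDeg Γ) X M.μ =
        A.conv (oneDeg Γ + oneDeg Γ) (A.strict h) (A.conv (oneDeg Γ) M.μ M.μ) :=
      A.conv_assoc _ _ _ _ _
    have hY : A.conv d' (A.conv (oneDeg Γ) N.μ N.μ) (A.strict h) =
        A.conv (d' + oneDeg Γ) N.μ Y := by
      rw [add_comm]
      exact A.conv_assoc _ _ _ _ _
    have hYX : A.conv (oneDeg Γ) Y M.μ = A.conv (d' + oneDeg Γ) N.μ X := A.conv_assoc _ _ _ _ _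
    have hu := units_map_smul (A.convₗ (M := M.carrier) (d' + oneDeg Γ) N.μ).toAddMonoidHom
      (sgn d') Y
    have hu' := units_map_smul
      ((A.convₗ (P := N.carrier) (oneDeg Γ)).flip M.μ).toAddMonoidHom (sgn d') Y
    have hs := map_sub ((A.convₗ (P := N.carrier) (oneDeg Γ)).flip M.μ) X (sgn d' • Y)
    have hs' := map_sub (A.convₗ (M := M.carrier) (d' + oneDeg Γ) N.μ) X (sgn d' • Y)
    have hd := units_map_smul (M.diff N (d' + oneDeg Γ)).toAddMonoidHom (sgn d') Y
    simp only [LinearMap.toAddMonoidHom_coe, LinearMap.flip_apply,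
      AInfAlgebra.convₗ_apply] at hu hu' hs hs' hd
    rw [diff_structure, e, hs, hu', hX, hYX, sgn_oneDeg, add_comm (oneDeg Γ) d'] at h1
    rw [diff_structure, e, hs', hu, hY] at h2
    show M.diff N (d' + oneDeg Γ) (M.diff N d' (A.strict h)) = 0
    rw [e, map_sub, hd, h1, h2, Units.neg_smul, one_smul]
    rw [sub_add_cancel]
    abel

/-- In a splitting of a word of length at most `r`, either the left part is shorter than `r` or the
right part is empty. -/
lemma conv_mem_lengthFiltration {r : ℕ} {f : List A.carrier → N.carrier →ₗ[K] P.carrier}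
    {g : List A.carrier → M.carrier →ₗ[K] N.carrier} (hf : f ∈ lengthFiltration r N P)
    (hg : g ∈ lengthFiltration 1 M N) (d : Γ) :
    A.conv d f g ∈ lengthFiltration (r + 1) M P := by
  intro l hl
  refine sum_eq_zero fun i hi => ?_
  have hi' := mem_range.1 hi
  by_cases h : i < r
  · rw [hf _ (by simp; omega), LinearMap.zero_comp]
  · rw [hg _ (by simp; omega), LinearMap.comp_zero]

lemma comp_mem_F {r : ℕ} {d₁ d₂ d : Γ} (h : d₁ + d₂ = d) {x : N.H P d₂} {y : M.H N d₁}
    (hx : x ∈ F r N P d₂) (hy : y ∈ F 1 M N d₁) : comp M N P h x y ∈ F (r + 1) M P d := by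
  obtain ⟨ψ, hψ, rfl⟩ := hx
  obtain ⟨φ, hφ, rfl⟩ := hy
  exact ⟨compZ M N P h ψ φ, conv_mem_lengthFiltration hψ hφ d₁, rfl⟩

lemma cls_eq_zero_iff {d : Γ} (φ : M.cocycles N d) :
    M.cls N d φ = 0 ↔ φ.1 ∈ M.boundaries N d :=
  Submodule.Quotient.mk_eq_zero _

lemma F_one_le_ghost (M N : AInfModule A) (d : Γ) : F 1 M N d ≤ ghost M N d := by
  rintro _ ⟨φ, hφ, rfl⟩ c y
  obtain ⟨ψ, rfl⟩ := Submodule.Quotient.mk_surjective _ y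
  refine (cls_eq_zero_iff (compZ (self A) M N rfl φ ψ)).2
    (mem_boundaries_of_nil_eq_zero _ (compZ (self A) M N rfl φ ψ).2 ?_)
  show A.conv c φ.1 ψ.1 [] = 0
  have h0 : φ.1 [] = 0 := hφ [] (by simp)
  simp [AInfAlgebra.conv, h0]

/-- The morphism `A → M` attached to the cycle `m` sends the unit to `± m`. Its composite with `φ`
is a boundary of some `χ`, and `A.e` is a cycle, so in length zero at the unit `± φ [] m` becomes
the boundary of `χ [] A.e` up to sign. -/
lemma exists_nil_eq_of_mem_ghost {d : Γ} {φ : M.cocycles N d}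
    (hφ : M.cls N d φ ∈ ghost M N d) {c : Γ} {m : M.carrier} (hm : m ∈ M.deg c)
    (h0 : M.μ [] m = 0) : ∃ n, N.μ [] n = φ.1 [] m := by
  have h := hφ c ((self A).cls M c ⟨_, slant_structure_mem_cocycles M hm h0⟩)
  rw [comp_cls, cls_eq_zero_iff] at h
  obtain ⟨χ, hχ, h⟩ := h
  have h1 : N.μ [] (χ [] A.e) = -(sgn (c + d - oneDeg Γ) • sgn (c - oneDeg Γ) • φ.1 [] m) := by
    have h2 := LinearMap.congr_fun (congr_fun h []) A.e
    have h3 := diff_nil (M := self A) hχ.1 (c + d - oneDeg Γ) A.e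
    have h4 : (self A).μ [] A.e = 0 := A.unit_zero [] [] (by simp)
    have h5 : A.slant M.multilin m (c - oneDeg Γ) [] A.e = sgn (c - oneDeg Γ) • m := by
      have := A.map_twist_append_unit M.multilin (c - oneDeg Γ) [] []
      rw [A.slant_apply, List.nil_append, ← List.nil_append [A.e], this]
      simp [M.unit_one]
    have h6 : (compZ (self A) M N rfl φ ⟨_, slant_structure_mem_cocycles M hm h0⟩).1 [] A.e =
        sgn (c - oneDeg Γ) • φ.1 [] m := by
      refine Eq.trans ?_ (units_map_smul (φ.1 []).toAddMonoidHom _ m)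
      rw [← h5]
      show A.conv c φ.1 (A.slant M.multilin m _) [] A.e = _
      simp [AInfAlgebra.conv]
    rw [h6, h3, h4, map_zero, zero_sub] at h2
    rw [← h2, smul_neg, neg_neg, smul_smul, Int.units_mul_self, one_smul]
  refine ⟨-(sgn (c - oneDeg Γ) • sgn (c + d - oneDeg Γ) • χ [] A.e), ?_⟩
  have hu : ∀ (ε : ℤˣ) y, N.μ [] (ε • y) = ε • N.μ [] y :=
    units_map_smul (N.μ []).toAddMonoidHom
  rw [map_neg, hu, hu, h1, smul_neg, smul_neg, neg_neg, smul_smul (sgn (c + d - _)),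
    Int.units_mul_self, one_smul, smul_smul, Int.units_mul_self, one_smul]

/-- A ghost is zero on the cohomology of the underlying complexes, hence null-homotopic there
because `K` is a field; the homotopy corrects the representative. -/
lemma ghost_le_F_one (M N : AInfModule A) (d : Γ) : ghost M N d ≤ F 1 M N d := by
  intro x hx
  obtain ⟨φ, rfl⟩ := Submodule.Quotient.mk_surjective _ x
  obtain ⟨s, hsdeg, hs⟩ := M.exists_graded_generalized_inverse (M.μ [])
    fun h x hx => M.structure_nil_mem hx
  obtain ⟨p, hpdeg, hp⟩ := N.exists_graded_generalized_inverse (N.μ [])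
    fun h x hx => N.structure_nil_mem hx
  obtain ⟨hφm, hφdeg, -⟩ := φ.2.1
  set f := φ.1 [] with hf
  have hfdeg : ∀ g, ∀ m ∈ M.deg g, f m ∈ N.deg (g + d) := fun g m hm => by
    simpa using hφdeg [] [] List.Forall₂.nil g m hm
  have hfD : ∀ m, f (M.μ [] m) = sgn d • N.μ [] (f m) := fun m => by
    rw [← sub_eq_zero, ← diff_nil hφm]
    exact LinearMap.congr_fun (congr_fun φ.2.2 []) m
  have hproj : ∀ g, ∀ m ∈ M.deg g, m - s (M.μ [] m) ∈ M.deg g := fun g m hm =>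
    sub_mem hm (by simpa using hsdeg _ _ (M.structure_nil_mem hm))
  have hpf : ∀ m, N.μ [] (p (f (m - s (M.μ [] m)))) = f (m - s (M.μ [] m)) := fun m => by
    refine M.induction_hom
      (P := fun m => N.μ [] (p (f (m - s (M.μ [] m)))) = f (m - s (M.μ [] m))) m
      (fun g m hm => ?_) (by simp) (fun x y hx hy => ?_)
    · obtain ⟨n, hn⟩ := exists_nil_eq_of_mem_ghost hx (hproj _ m hm)
        (by rw [map_sub, hs, sub_self])
      rw [← hn, hp]
    · rw [show x + y - s (M.μ [] (x + y)) = (x - s (M.μ [] x)) + (y - s (M.μ [] y)) by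
        rw [map_add, map_add]; abel, map_add, map_add, map_add, hx, hy]
  -- The homotopy of `exists_homotopy` with `ε = sgn d`.
  let h : M.carrier →ₗ[K] N.carrier :=
    sgn d • (p ∘ₗ f ∘ₗ (LinearMap.id - s ∘ₗ M.μ [])) + f ∘ₗ s - sgn d • (p ∘ₗ f ∘ₗ M.μ [] ∘ₗ s)
  have hdeg : ∀ g, ∀ m ∈ M.deg g, h m ∈ N.deg (g + (d - oneDeg Γ)) := fun g m hm => by
    refine sub_mem (add_mem (units_smul_mem _ _ ?_) ?_) (units_smul_mem _ _ ?_)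
    · rw [← add_sub_assoc]
      exact hpdeg _ _ (hfdeg _ _ (hproj g m hm))
    · rw [add_sub_left_comm, add_comm]
      exact hfdeg _ _ (hsdeg _ _ hm)
    · rw [← add_sub_assoc]
      have := M.structure_nil_mem (hsdeg _ _ hm)
      rw [sub_add_cancel] at this
      exact hpdeg _ _ (hfdeg _ _ this)
  have hmem : M.diff N (d - oneDeg Γ) (A.strict h) ∈ M.cocycles N d :=
    diff_strict_mem_cocycles (sub_add_cancel _ _) hdeg
  -- In length zero the differential of `A.strict h` equals `f`; on longer words it may be nonzero,
  -- which does no harm.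
  refine ⟨φ - ⟨_, hmem⟩, fun l hl => ?_, ?_⟩
  · obtain rfl : l = [] := List.length_eq_zero_iff.1 (by omega)
    refine LinearMap.ext fun m => ?_
    show f m - M.diff N _ (A.strict h) [] m = 0
    rw [diff_nil (A.strict_isMultilin h), sgn_sub_oneDeg, Units.neg_smul, sub_neg_eq_add,
      sub_eq_zero]
    exact exists_homotopy (sgn d) M.structure_nil_nil hfD hs hpf m
  · have : M.cls N d ⟨_, hmem⟩ = 0 :=
      (cls_eq_zero_iff _).2 ⟨_, strict_mem_Hom hdeg, rfl⟩
    rw [map_sub, this, sub_zero]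
    rfl

end AInfModule

/-! ### The grading on the cone. -/

/-- The coefficients of `ρ` read off the homogeneous components, so these are unique. This suits
gradings given by spanning sets, such as that of a tensor product. -/
lemma isInternal_of_coaction {V : Type*} [AddCommGroup V] [Module K V] {deg : Γ → Submodule K V}
    (ρ : V →ₗ[K] Γ →₀ V) (hρ : ∀ g, ∀ x ∈ deg g, ρ x = Finsupp.single g x)
    (htop : ⨆ g, deg g = ⊤) : DirectSum.IsInternal deg := by
  have key : ∀ (x : DirectSum Γ fun g => deg g) (k : Γ),
      ρ (DirectSum.coeLinearMap deg x) k = x k := fun x k => by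
    induction x using DirectSum.induction_on with
    | zero => simp
    | of i y =>
      have h : DirectSum.coeLinearMap deg (DirectSum.of (fun g => deg g) i y) = y :=
        DirectSum.coeLinearMap_lof (A := deg) i y
      rw [h, hρ i y y.2, DirectSum.of_apply, Finsupp.single_apply]
      split_ifs with hik
      · subst hik; rfl
      · rfl
    | add x y hx hy => simp [hx, hy]
  refine ⟨(injective_iff_map_eq_zero _).2 fun x hx => ?_, fun x => ?_⟩
  · refine DFinsupp.ext fun k => Subtype.ext ?_
    have h : DirectSum.coeLinearMap deg x = 0 := hx
    have := key x k
    rw [h, map_zero] at this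
    exact this.symm
  · have : x ∈ ⨆ g, deg g := htop ▸ Submodule.mem_top
    rw [← DirectSum.range_coeLinearMap] at this
    exact this

namespace GrVect

variable (V : GrVect.{u, v, w} K Γ)

/-- The coaction `a ↦ ∑ g, g ⊗ a_g` of the group ring of `Γ` that corresponds to the grading. -/
def coaction : V.carrier →ₗ[K] Γ →₀ V.carrier :=
  (DirectSum.toModule K Γ (Γ →₀ V.carrier) fun g => Finsupp.lsingle g ∘ₗ (V.deg g).subtype) ∘ₗ
    V.decomp.symm.toLinearMap

lemma coaction_of_mem {g : Γ} {a : V.carrier} (h : a ∈ V.deg g) :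
    V.coaction a = Finsupp.single g a := by
  have h1 : V.decomp.symm a = DirectSum.lof K Γ (fun i => V.deg i) g ⟨a, h⟩ := by
    rw [LinearEquiv.symm_apply_eq]
    exact (DirectSum.coeLinearMap_lof (A := V.deg) g ⟨a, h⟩).symm
  simp [coaction, h1, DirectSum.toModule_lof]

variable (M : GrVect.{u, v, w} K Γ)

open TensorProduct

/-- The homogeneous elements of degree `k` of `M ⊕ (sV ⊗ M)`. -/
def coneDeg (k : Γ) : Submodule K (M.carrier × (V.carrier ⊗[K] M.carrier)) :=
  Submodule.span K ({x | ∃ m ∈ M.deg k, x = (m, 0)} ∪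
    {x | ∃ g h, g + h = k ∧ ∃ a ∈ V.deg (g + oneDeg Γ), ∃ m ∈ M.deg h, x = (0, a ⊗ₜ m)})

variable {V M}

lemma inl_mem_coneDeg {k : Γ} {m : M.carrier} (hm : m ∈ M.deg k) :
    (m, (0 : V.carrier ⊗[K] M.carrier)) ∈ V.coneDeg M k :=
  Submodule.subset_span (Or.inl ⟨m, hm, rfl⟩)

lemma inr_mem_coneDeg {g h k : Γ} (hk : g + h = k) {a : V.carrier} (ha : a ∈ V.deg (g + oneDeg Γ))
    {m : M.carrier} (hm : m ∈ M.deg h) : ((0 : M.carrier), a ⊗ₜ[K] m) ∈ V.coneDeg M k :=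
  Submodule.subset_span (Or.inr ⟨g, h, hk, a, ha, m, hm, rfl⟩)

lemma coneDeg_le {W : Type*} [AddCommGroup W] [Module K W]
    {f : M.carrier × (V.carrier ⊗[K] M.carrier) →ₗ[K] W} {S : Submodule K W} {k : Γ}
    (h1 : ∀ m ∈ M.deg k, f (m, 0) ∈ S)
    (h2 : ∀ g h, g + h = k → ∀ a ∈ V.deg (g + oneDeg Γ), ∀ m ∈ M.deg h, f (0, a ⊗ₜ m) ∈ S) :
    ∀ x ∈ V.coneDeg M k, f x ∈ S := by
  intro x hx
  have : V.coneDeg M k ≤ S.comap f := by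
    refine Submodule.span_le.2 ?_
    rintro _ (⟨m, hm, rfl⟩ | ⟨g, h, hk, a, ha, m, hm, rfl⟩)
    · exact h1 m hm
    · exact h2 g h hk a ha m hm
  exact this hx

variable (V M)

lemma iSup_coneDeg : ⨆ k, V.coneDeg M k = ⊤ := by
  refine eq_top_iff.2 fun x _ => ?_
  have h1 : ∀ m : M.carrier, (m, (0 : V.carrier ⊗[K] M.carrier)) ∈ ⨆ k, V.coneDeg M k := fun m => by
    refine M.induction_hom (P := fun m => (m, (0 : V.carrier ⊗[K] M.carrier)) ∈ ⨆ k, V.coneDeg M k)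
      m (fun g x hx => ?_) (zero_mem _) (fun x y hx hy => ?_)
    · exact Submodule.mem_iSup_of_mem _ (inl_mem_coneDeg hx)
    · simpa using add_mem hx hy
  have h2 : ∀ t : V.carrier ⊗[K] M.carrier, ((0 : M.carrier), t) ∈ ⨆ k, V.coneDeg M k := fun t => by
    induction t with
    | zero => exact zero_mem _
    | add x y hx hy => simpa using add_mem hx hy
    | tmul a m =>
      refine V.induction_hom
        (P := fun a => ((0 : M.carrier), a ⊗ₜ[K] m) ∈ ⨆ k, V.coneDeg M k) a
        (fun g x hx => ?_) ?_ (fun x y hx hy => ?_)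
      · refine M.induction_hom
          (P := fun m => ((0 : M.carrier), x ⊗ₜ[K] m) ∈ ⨆ k, V.coneDeg M k) m
          (fun h y hy => ?_) ?_ (fun y z hy hz => ?_)
        · exact Submodule.mem_iSup_of_mem _ (inr_mem_coneDeg rfl hx hy)
        · rw [tmul_zero]; exact zero_mem _
        · simpa [tmul_add] using add_mem hy hz
      · rw [zero_tmul]; exact zero_mem _
      · simpa [add_tmul] using add_mem hx hy
  simpa using add_mem (h1 x.1) (h2 x.2)

/-- The graded vector space `M ⊕ (sV ⊗ M)`. -/
abbrev cone : GrVect.{u, v, w} K Γ where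
  carrier := M.carrier × (V.carrier ⊗[K] M.carrier)
  deg := V.coneDeg M
  internal := by
    -- The tensor product of the two coactions, pushed forward along addition of degrees; the shift
    -- by `oneDeg Γ` passes from degrees in `V` to degrees in `sV`.
    let ρ₂ : V.carrier ⊗[K] M.carrier →ₗ[K] Γ →₀ M.carrier × (V.carrier ⊗[K] M.carrier) :=
      Finsupp.lmapDomain _ K (fun p : Γ × Γ => p.1 - oneDeg Γ + p.2) ∘ₗ
        Finsupp.mapRange.linearMap (LinearMap.inr K _ _) ∘ₗ
        (finsuppTensorFinsupp K K V.carrier M.carrier Γ Γ).toLinearMap ∘ₗ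
        TensorProduct.map V.coaction M.coaction
    let ρ₁ : M.carrier →ₗ[K] Γ →₀ M.carrier × (V.carrier ⊗[K] M.carrier) :=
      Finsupp.mapRange.linearMap (LinearMap.inl K _ _) ∘ₗ M.coaction
    refine isInternal_of_coaction (ρ₁.coprod ρ₂) (fun k x hx => ?_) (V.iSup_coneDeg M)
    have := coneDeg_le (f := ρ₁.coprod ρ₂ - Finsupp.lsingle k) (S := ⊥) (k := k)
      (fun m hm => ?_) (fun g h hk a ha m hm => ?_) x hx
    · simpa [sub_eq_zero] using this
    · simp [ρ₁, M.coaction_of_mem hm]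
    · simp [ρ₂, M.coaction_of_mem hm, V.coaction_of_mem ha, hk, Finsupp.mapDomain_single]

end GrVect

lemma IsMultilin.add {V : Type*} [AddCommGroup V] [Module K V] {W : Type*} [AddCommGroup W]
    [Module K W] {f g : List V → W} (hf : IsMultilin K f) (hg : IsMultilin K g) :
    IsMultilin K (f + g) := by
  refine ⟨fun l l' a b => ?_, fun l l' c a => ?_⟩
  · simp only [Pi.add_apply, hf.1, hg.1]
    abel
  · simp only [Pi.add_apply, hf.2, hg.2, smul_add]

/-! ### The free module on a complex, and maps out of it. -/

open TensorProduct

namespace AInfAlgebra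

variable (A : AInfAlgebra.{u, v, w} K Γ)

section Absorb

variable {M N P : Type*} [AddCommGroup M] [Module K M] [AddCommGroup N] [Module K N]
  [AddCommGroup P] [Module K P]

/-- The map `BA ⊗ (sA ⊗ M) → N` that is the restriction of `φ : BA ⊗ M → N` to the words of
positive length. -/
def absorb {φ : List A.carrier → M →ₗ[K] N} (hφ : IsMultilin K φ) (l : List A.carrier) :
    A.carrier ⊗[K] M →ₗ[K] N :=
  TensorProduct.lift (A.splitLast hφ l)

variable {φ : List A.carrier → M →ₗ[K] N} (hφ : IsMultilin K φ)

@[simp] lemma absorb_tmul (l : List A.carrier) (a : A.carrier) (m : M) :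
    A.absorb hφ l (a ⊗ₜ m) = φ (l ++ [a]) m := rfl

lemma absorb_isMultilin : IsMultilin K (A.absorb hφ) := by
  have h := A.splitLast_isMultilin hφ
  refine ⟨fun l l' a b => TensorProduct.ext' fun x m => ?_,
    fun l l' c a => TensorProduct.ext' fun x m => ?_⟩
  · exact LinearMap.congr_fun (LinearMap.congr_fun (h.1 l l' a b) x) m
  · exact LinearMap.congr_fun (LinearMap.congr_fun (h.2 l l' c a) x) m

/-- The differential `a ⊗ m ↦ (-1)^{|a|} a ⊗ D m` of `sA ⊗ M`. -/
def tensorDiff (D : M →ₗ[K] M) : A.carrier ⊗[K] M →ₗ[K] A.carrier ⊗[K] M :=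
  TensorProduct.map (A.twist (oneDeg Γ)) D

@[simp] lemma tensorDiff_tmul (D : M →ₗ[K] M) (a : A.carrier) (m : M) :
    A.tensorDiff D (a ⊗ₜ m) = A.twist (oneDeg Γ) a ⊗ₜ D m := rfl

/-- The structure map of the free module `sA ⊗ M` on the complex `(M, D)`. -/
def tensorOp (D : M →ₗ[K] M) : List A.carrier → A.carrier ⊗[K] M →ₗ[K] A.carrier ⊗[K] M :=
  (fun l => (A.selfOp l).rTensor M) + A.strict (A.tensorDiff D)

lemma tensorOp_tmul (D : M →ₗ[K] M) (l : List A.carrier) (a : A.carrier) (m : M) :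
    A.tensorOp D l (a ⊗ₜ m) =
      A.μ (l ++ [a]) ⊗ₜ m + A.strict (A.tensorDiff D) l (a ⊗ₜ m) := rfl

lemma selfOp_isMultilin : IsMultilin K A.selfOp := (AInfModule.self A).multilin

lemma selfOp_rTensor_isMultilin :
    IsMultilin K (fun l => (A.selfOp l).rTensor M : List A.carrier → _) :=
  A.selfOp_isMultilin.comp_linear (LinearMap.rTensorHom M)

lemma tensorOp_isMultilin (D : M →ₗ[K] M) : IsMultilin K (A.tensorOp D) :=
  A.selfOp_rTensor_isMultilin.add (A.strict_isMultilin _)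

/-- The square of the `A`-part is the relation of `A` tensored with `M`, the square of the `D`-part
is zero, and the mixed terms cancel because `μ` is odd for the twist. -/
lemma tensorOp_relation {D : M →ₗ[K] M} (hD : ∀ m, D (D m) = 0) :
    A.conv (oneDeg Γ) (A.tensorOp D) (A.tensorOp D) + A.barD (A.tensorOp D) = 0 := by
  have h1 : A.conv (oneDeg Γ) (fun l => (A.selfOp l).rTensor M) (fun l => (A.selfOp l).rTensor M) +
      A.barD (fun l => (A.selfOp l).rTensor M : List A.carrier → _) = 0 := by
    ext l : 1
    have h := congr_arg (LinearMap.rTensor M) ((AInfModule.self A).relation l)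
    change LinearMap.rTensor M (A.conv (oneDeg Γ) A.selfOp A.selfOp l + A.barD A.selfOp l) =
      LinearMap.rTensor M 0 at h
    rw [LinearMap.rTensor_zero] at h
    refine Eq.trans ?_ h
    refine TensorProduct.ext' fun a m => ?_
    simp [conv, GrVect.insertOp, sum_tmul]
  ext l : 1
  refine TensorProduct.ext' fun a m => ?_
  have h2 := LinearMap.congr_fun (congr_fun h1 l) (a ⊗ₜ m)
  have h3 : A.conv (oneDeg Γ) (A.strict (A.tensorDiff D)) (A.strict (A.tensorDiff D)) l = 0 := by
    refine TensorProduct.ext' fun a m => ?_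
    rw [conv_strict_left]
    cases l <;> simp [hD]
  have h4 := A.μ_twist (oneDeg Γ) (l ++ [a])
  rw [sgn_oneDeg, Units.neg_smul, one_smul] at h4
  rw [tensorOp, conv_add_left, conv_add_right, conv_add_right, barD_add, barD_strict]
  simp only [Pi.add_apply, Pi.zero_apply, LinearMap.add_apply, LinearMap.zero_apply, h3,
    conv_strict_left, conv_strict_right, LinearMap.comp_apply, add_zero] at h2 ⊢
  rw [add_assoc, add_assoc, add_left_comm, add_comm (A.conv _ _ _ _ _), add_assoc,
    add_comm (A.barD (fun l => (A.selfOp l).rTensor M : List A.carrier → _) l (a ⊗ₜ m)), h2,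
    add_zero]
  simp only [tensorDiff_tmul, LinearMap.rTensor_tmul, selfOp_apply]
  rw [List.map_append, List.map_cons, List.map_nil] at h4
  rw [h4, neg_tmul, neg_add_cancel]

/-- The terms for the word `l ++ [a]` are sorted by the role of `a`: it acts on `m` (first summand),
it enters an operation of `A` or stays untouched while `D` acts on `m` (second), or the operation
lies inside `l` (third). -/
lemma conv_absorb {D : M →ₗ[K] M} {μM : List A.carrier → M →ₗ[K] M} (hM : IsMultilin K μM)
    (hD : μM [] = D) (l : List A.carrier) (a : A.carrier) (m : M) :
    A.conv (oneDeg Γ) φ (A.absorb hM) l (a ⊗ₜ m) +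
        A.conv (oneDeg Γ) (A.absorb hφ) (A.tensorOp D) l (a ⊗ₜ m) +
        A.barD (A.absorb hφ) l (a ⊗ₜ m) =
      A.conv (oneDeg Γ) φ μM (l ++ [a]) m + A.barD φ (l ++ [a]) m := by
  have h1 : A.barD (A.absorb hφ) l (a ⊗ₜ m) = A.barD (fun t => φ (t ++ [a])) l m := by
    simp [GrVect.insertOp]
  rw [conv_concat, A.barD_concat hφ, tensorOp, conv_add_right, Pi.add_apply, conv_strict_right, h1]
  simp only [conv, LinearMap.add_apply, LinearMap.sum_apply, LinearMap.comp_apply, absorb_tmul,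
    tensorDiff_tmul, LinearMap.rTensor_tmul, selfOp_apply, hD, List.map_append, List.map_cons,
    List.map_nil]
  abel

lemma conv_absorb_right (d : Γ) (f : List A.carrier → N →ₗ[K] P) (h0 : φ [] = 0)
    (l : List A.carrier) (a : A.carrier) (m : M) :
    A.conv d f (A.absorb hφ) l (a ⊗ₜ m) = A.conv d f φ (l ++ [a]) m := by
  rw [conv_concat, h0]
  simp [conv]

end Absorb

end AInfAlgebra

/-! ### The cone of the action. -/

namespace AInfModule

variable {A : AInfAlgebra.{u, v, w} K Γ}

/-- The structure map of `M ⊕ (sA ⊗ M)`. -/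
def coneOp (M : AInfModule A) (l : List A.carrier) :
    M.carrier × (A.carrier ⊗[K] M.carrier) →ₗ[K] M.carrier × (A.carrier ⊗[K] M.carrier) :=
  ((M.μ l).coprod (A.absorb M.multilin l)).prod (A.tensorOp (M.μ []) l ∘ₗ LinearMap.snd K _ _)

/-- The extension of `φ : BA ⊗ M → N` to `BA ⊗ (M ⊕ (sA ⊗ M)) → N` by its own components. -/
def coneDesc {M : AInfModule A} {N : Type*} [AddCommGroup N] [Module K N]
    {φ : List A.carrier → M.carrier →ₗ[K] N}
    (hφ : IsMultilin K φ) (l : List A.carrier) :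
    M.carrier × (A.carrier ⊗[K] M.carrier) →ₗ[K] N :=
  (φ l).coprod (A.absorb hφ l)

section ConeOp

variable (M : AInfModule A) {N : Type*} [AddCommGroup N] [Module K N]
  {P : Type*} [AddCommGroup P] [Module K P]
  {φ : List A.carrier → M.carrier →ₗ[K] N} (hφ : IsMultilin K φ)

lemma coneOp_apply (l : List A.carrier) (m : M.carrier) (t : A.carrier ⊗[K] M.carrier) :
    M.coneOp l (m, t) = (M.μ l m + A.absorb M.multilin l t, A.tensorOp (M.μ []) l t) := rfl

lemma coneDesc_apply (l : List A.carrier) (m : M.carrier) (t : A.carrier ⊗[K] M.carrier) :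
    coneDesc hφ l (m, t) = φ l m + A.absorb hφ l t := rfl

lemma coneDesc_isMultilin : IsMultilin K (coneDesc hφ) := by
  have h := A.absorb_isMultilin hφ
  refine ⟨fun l l' a b => ?_, fun l l' c a => ?_⟩
  · simp only [coneDesc, hφ.1, h.1]
    ext <;> simp
  · simp only [coneDesc, hφ.2, h.2]
    ext <;> simp

lemma coneOp_isMultilin : IsMultilin K M.coneOp := by
  have h1 := coneDesc_isMultilin M M.multilin
  have h2 := A.tensorOp_isMultilin (M.μ [])
  refine ⟨fun l l' a b => LinearMap.ext fun x => Prod.ext ?_ ?_,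
    fun l l' c a => LinearMap.ext fun x => Prod.ext ?_ ?_⟩
  · exact LinearMap.congr_fun (h1.1 l l' a b) x
  · exact LinearMap.congr_fun (h2.1 l l' a b) x.2
  · exact LinearMap.congr_fun (h1.2 l l' c a) x
  · exact LinearMap.congr_fun (h2.2 l l' c a) x.2

/-- Evaluation on the cone reduces to `M` with the words `l` and `l ++ [a]`. Taking `φ = M.μ` gives
the first component of the module relation of the cone; for closed `φ` it gives the closedness of
the extension. -/
lemma coneOp_tmul_conv (l : List A.carrier) (m : M.carrier) (a : A.carrier) (m' : M.carrier) :
    A.conv (oneDeg Γ) (coneDesc hφ) M.coneOp l (m, a ⊗ₜ m') +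
      A.barD (coneDesc hφ) l (m, a ⊗ₜ m') =
    (A.conv (oneDeg Γ) φ M.μ l m + A.barD φ l m) +
      (A.conv (oneDeg Γ) φ M.μ (l ++ [a]) m' + A.barD φ (l ++ [a]) m') := by
  rw [← A.conv_absorb hφ M.multilin rfl]
  simp only [AInfAlgebra.conv, GrVect.insertOp, LinearMap.sum_apply, LinearMap.comp_apply,
    coneOp_apply, coneDesc_apply, map_add, sum_add_distrib]
  abel

end ConeOp

lemma linearMap_ext_cone {V M W : Type*} [AddCommGroup V] [Module K V] [AddCommGroup M]
    [Module K M] [AddCommGroup W] [Module K W] {f g : M × (V ⊗[K] M) →ₗ[K] W}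
    (h : ∀ m a m', f (m, a ⊗ₜ m') = g (m, a ⊗ₜ m')) : f = g := by
  refine LinearMap.prod_ext (LinearMap.ext fun m => ?_) (TensorProduct.ext' fun a m => ?_)
  · simpa using h m 0 0
  · exact h 0 a m

lemma coneOp_relation (M : AInfModule A) (l : List A.carrier) :
    A.conv (oneDeg Γ) M.coneOp M.coneOp l + A.barD M.coneOp l = 0 := by
  refine linearMap_ext_cone fun m a m' => Prod.ext ?_ ?_
  · have h := coneOp_tmul_conv M M.multilin l m a m'
    have h1 := LinearMap.congr_fun (M.relation l) m
    have h2 := LinearMap.congr_fun (M.relation (l ++ [a])) m'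
    rw [LinearMap.add_apply, LinearMap.zero_apply] at h1 h2
    rw [h1, h2, add_zero] at h
    refine Eq.trans ?_ h
    simp [AInfAlgebra.conv, GrVect.insertOp, Prod.fst_sum]
    rfl
  · have h := LinearMap.congr_fun (congr_fun (A.tensorOp_relation M.structure_nil_nil) l)
      (a ⊗ₜ m')
    refine Eq.trans ?_ h
    simp [AInfAlgebra.conv, GrVect.insertOp, Prod.snd_sum]
    rfl

/-- The cone `M ⊕ (sA ⊗ M)` of the action `A ⊗ M → M`, where `A ⊗ M` is the free module on the
complex `M`. -/
abbrev cone (M : AInfModule A) : AInfModule A where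
  toGrVect := A.toGrVect.cone M.toGrVect
  μ := M.coneOp
  multilin := M.coneOp_isMultilin
  degree l gs hl k := by
    refine GrVect.coneDeg_le (fun m hm => ?_) (fun g h hk a ha m hm => ?_)
    · rw [coneOp_apply, map_zero, map_zero, add_zero]
      exact GrVect.inl_mem_coneDeg (M.degree l gs hl k m hm)
    · have hla : A.HasSuspDegrees (l ++ [a]) (gs ++ [g]) :=
        List.rel_append hl (List.Forall₂.cons ha List.Forall₂.nil)
      have e : M.coneOp l (0, a ⊗ₜ m) = (M.μ (l ++ [a]) m, 0) + (0, A.μ (l ++ [a]) ⊗ₜ m) +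
          (0, A.strict (A.tensorDiff (M.μ [])) l (a ⊗ₜ m)) := by
        rw [coneOp_apply, A.tensorOp_tmul]
        simp
      rw [e]
      subst hk
      refine add_mem (add_mem (GrVect.inl_mem_coneDeg ?_) (GrVect.inr_mem_coneDeg ?_
        (A.degree _ _ hla) hm)) ?_
      · have := M.degree _ _ hla h m hm
        simpa [add_assoc] using this
      · simp only [List.sum_append, List.sum_singleton]
        abel
      · cases hl with
        | nil =>
          refine GrVect.inr_mem_coneDeg (g := g) (h := h + oneDeg Γ) ?_ ?_ (M.structure_nil_mem hm)
          · simp [add_assoc]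
          · rw [A.twist_of_susp _ ha]
            exact units_smul_mem _ _ ha
        | cons _ _ => exact zero_mem _
  relation := M.coneOp_relation
  unit_one := by
    refine linearMap_ext_cone fun m a m' => ?_
    have h1 : M.μ [A.e, a] = 0 := M.unit_zero [] [a] (by simp)
    rw [coneOp_apply, A.tensorOp_tmul]
    simp [M.unit_one, h1, A.unit_left]
  unit_zero l l' h := by
    refine linearMap_ext_cone fun m a m' => ?_
    have h1 : M.μ (l ++ A.e :: (l' ++ [a])) = 0 := M.unit_zero _ _ (by simp)
    have h2 : A.μ (l ++ A.e :: (l' ++ [a])) = 0 := A.unit_zero _ _ (by simp; omega)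
    rw [coneOp_apply, A.tensorOp_tmul]
    simp [M.unit_zero l l' h, h1, h2]

/-! ### Factorization through the cone, and the induction. -/

variable {M N : AInfModule A}

lemma inl_mem_deg {g : Γ} {m : M.carrier} (hm : m ∈ M.deg g) :
    LinearMap.inl K M.carrier (A.carrier ⊗[K] M.carrier) m ∈ M.cone.deg (g + 0) := by
  rw [add_zero]
  exact GrVect.inl_mem_coneDeg hm

/-- The inclusion of `M` into the cone. -/
abbrev coneInl (M : AInfModule A) : List A.carrier → M.carrier →ₗ[K] M.cone.carrier :=
  A.strict (LinearMap.inl K M.carrier (A.carrier ⊗[K] M.carrier))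

lemma coneInl_mem_cocycles (M : AInfModule A) : M.coneInl ∈ M.cocycles M.cone 0 := by
  refine ⟨strict_mem_Hom fun g m hm => inl_mem_deg hm, funext fun l => ?_⟩
  rw [diff_strict_apply, sgn_zero, one_smul, GrVect.twist_zero, LinearMap.id_coe, List.map_id]
  refine LinearMap.ext fun m => ?_
  show (M.μ l m, 0) - M.coneOp l (m, 0) = 0
  rw [coneOp_apply]
  simp

lemma coneInl_mem_ghost (M : AInfModule A) :
    M.cls M.cone 0 ⟨_, M.coneInl_mem_cocycles⟩ ∈ ghost M M.cone 0 := by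
  -- The contraction `m ↦ e ⊗ m`. Its differential in length zero is `m ↦ (m, 0)`: the unit acts as
  -- the identity, and the two terms `e ⊗ M.μ [] m` have opposite signs. So the inclusion is
  -- cohomologous to a cocycle in the first filtration step.
  let h : M.carrier →ₗ[K] M.cone.carrier :=
    LinearMap.inr K M.carrier (A.carrier ⊗[K] M.carrier) ∘ₗ TensorProduct.mk K _ _ A.e
  have hdeg : ∀ g, ∀ m ∈ M.deg g, h m ∈ M.cone.deg (g + (0 - oneDeg Γ)) := fun g m hm =>
    GrVect.inr_mem_coneDeg (add_comm _ _) (by rw [sub_add_cancel]; exact A.e_mem) hm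
  have hmem : M.diff M.cone (0 - oneDeg Γ) (A.strict h) ∈ M.cocycles M.cone 0 :=
    diff_strict_mem_cocycles (sub_add_cancel _ _) hdeg
  refine F_one_le_ghost _ _ _ ⟨⟨_, M.coneInl_mem_cocycles⟩ - ⟨_, hmem⟩, fun l hl => ?_, ?_⟩
  · obtain rfl : l = [] := List.length_eq_zero_iff.1 (by omega)
    refine LinearMap.ext fun m => ?_
    show (m, 0) - M.diff M.cone _ (A.strict h) [] m = 0
    rw [diff_nil (A.strict_isMultilin h), sgn_sub_oneDeg, sgn_zero, Units.neg_smul, one_smul,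
      sub_neg_eq_add]
    show (m, 0) - ((0, A.e ⊗ₜ M.μ [] m) + M.coneOp [] (0, A.e ⊗ₜ m)) = 0
    have h1 : A.μ [A.e] = 0 := A.unit_zero [] [] (by simp)
    rw [coneOp_apply, A.tensorOp_tmul]
    simp [M.unit_one, h1, A.twist_e_eq, sgn_oneDeg, neg_tmul]
  · have : M.cls M.cone 0 ⟨_, hmem⟩ = 0 :=
      (cls_eq_zero_iff _).2 ⟨_, strict_mem_Hom hdeg, rfl⟩
    rw [map_sub, this, sub_zero]

lemma coneDesc_mem_cocycles {d : Γ} {φ : List A.carrier → M.carrier →ₗ[K] N.carrier}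
    (hφ : φ ∈ M.cocycles N d) (h0 : φ [] = 0) :
    coneDesc hφ.1.1 ∈ M.cone.cocycles N d := by
  obtain ⟨⟨hm, hdeg, hu⟩, hd⟩ := hφ
  refine ⟨⟨coneDesc_isMultilin M hm, fun l gs hl k => ?_, fun l l' => ?_⟩, funext fun l => ?_⟩
  · refine GrVect.coneDeg_le (fun m hm => ?_) (fun g h hk a ha m hm => ?_)
    · rw [coneDesc_apply, map_zero, add_zero]
      exact hdeg l gs hl k m hm
    · have hla : A.HasSuspDegrees (l ++ [a]) (gs ++ [g]) :=
        List.rel_append hl (List.Forall₂.cons ha List.Forall₂.nil)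
      subst hk
      rw [coneDesc_apply, map_zero, zero_add, A.absorb_tmul]
      simpa [add_assoc] using hdeg _ _ hla h m hm
  · refine linearMap_ext_cone fun m a m' => ?_
    rw [coneDesc_apply, A.absorb_tmul, List.append_assoc, List.cons_append, hu, hu]
    simp
  · refine linearMap_ext_cone fun m a m' => ?_
    have h1 := coneOp_tmul_conv M hm l m a m'
    have hd' : ∀ t, A.conv (oneDeg Γ) φ M.μ t + A.barD φ t - sgn d • A.conv d N.μ φ t = 0 :=
      fun t => congr_fun hd t
    have h2 := LinearMap.congr_fun (hd' l) m
    have h3 := LinearMap.congr_fun (hd' (l ++ [a])) m'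
    -- Here `φ [] = 0` is essential: the term `N.μ (l ++ [a]) (φ [] m')`, up to sign, has no
    -- counterpart on the cone.
    have h4 : A.conv d N.μ (coneDesc hm) l (m, a ⊗ₜ m') =
        A.conv d N.μ φ l m + A.conv d N.μ φ (l ++ [a]) m' := by
      rw [← A.conv_absorb_right hm d N.μ h0]
      simp [AInfAlgebra.conv, coneDesc_apply, sum_add_distrib]
    change A.conv (oneDeg Γ) (coneDesc hm) M.coneOp l (m, a ⊗ₜ m') +
      A.barD (coneDesc hm) l (m, a ⊗ₜ m') -
      sgn d • A.conv d N.μ (coneDesc hm) l (m, a ⊗ₜ m') = 0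
    change A.conv (oneDeg Γ) φ M.μ l m + A.barD φ l m - sgn d • A.conv d N.μ φ l m = 0 at h2
    change A.conv (oneDeg Γ) φ M.μ _ m' + A.barD φ _ m' - sgn d • A.conv d N.μ φ _ m' = 0 at h3
    rw [h1, h4, smul_add, add_sub_add_comm, h2, h3, add_zero]

/-- The representative itself factors strictly: restricting its extension along the inclusion of `M`
gives it back, with no correction by a boundary. -/
lemma F_succ_le {r : ℕ} {M N : AInfModule A} {d : Γ} {x : M.H N d} (hx : x ∈ F (r + 1) M N d) :
    ∃ (y : M.H M.cone 0) (z : M.cone.H N d), y ∈ ghost M M.cone 0 ∧ z ∈ F r M.cone N d ∧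
      x = comp M M.cone N (zero_add d) z y := by
  obtain ⟨φ, hφ, rfl⟩ := hx
  have h0 : φ.1 [] = 0 := hφ [] (by simp)
  refine ⟨_, M.cone.cls N d ⟨_, coneDesc_mem_cocycles φ.2 h0⟩, M.coneInl_mem_ghost,
    ⟨_, fun l hl => linearMap_ext_cone fun m a m' => ?_, rfl⟩, ?_⟩
  · show coneDesc φ.2.1.1 l (m, a ⊗ₜ m') = 0
    have h1 : φ.1 l = 0 := hφ l (by omega)
    -- The absorbed letter makes the word longer by one, which is where one filtration step is lost.
    have h2 : φ.1 (l ++ [a]) = 0 := hφ (l ++ [a]) (by simpa using hl)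
    rw [coneDesc_apply, A.absorb_tmul, h1, h2]
    simp
  · rw [comp_cls]
    refine congr_arg (M.cls N d) (Subtype.ext (funext fun l => LinearMap.ext fun m => ?_))
    show φ.1 l m = A.conv 0 (coneDesc φ.2.1.1) M.coneInl l m
    rw [A.conv_strict_right, GrVect.twist_zero, LinearMap.id_coe, List.map_id]
    show _ = coneDesc φ.2.1.1 l (m, 0)
    rw [coneDesc_apply, map_zero, add_zero]

theorem ghostPow_eq_F (r : ℕ) (M N : AInfModule A) (d : Γ) : ghostPow r M N d = F r M N d := by
  induction r generalizing M N d with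
  | zero =>
    refine (eq_top_iff.2 fun x _ => ?_).symm
    obtain ⟨φ, rfl⟩ := Submodule.Quotient.mk_surjective _ x
    exact ⟨φ, fun l hl => absurd hl (Nat.not_lt_zero _), rfl⟩
  | succ r ih =>
    refine le_antisymm (Submodule.span_le.2 ?_) fun x hx => ?_
    · rintro _ ⟨L, d₁, d₂, h, y, hy, x, hx, rfl⟩
      rw [ih] at hx
      exact comp_mem_F h hx (ghost_le_F_one _ _ _ hy)
    · obtain ⟨y, z, hy, hz, rfl⟩ := F_succ_le hx
      exact Submodule.subset_span ⟨M.cone, 0, d, zero_add d, y, hy, z, by rwa [ih], rfl⟩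

end AInfModule

end

/-- For every `A∞`-algebra `A` and every `r`, the `r`-th power of the ghost ideal equals the
`r`-th piece of the length filtration, on all morphisms `M → N` of all degrees `d`. -/
theorem mainTheorem1 {K : Type u} [Field K] {Γ : Type w} [AddCommGroup Γ] [DecidableEq Γ]
    [GradingGroup Γ] (A : AInfAlgebra.{u, v, w} K Γ) (r : ℕ) (M N : AInfModule A) (d : Γ) :
    AInfModule.ghostPow r M N d = AInfModule.F r M N d := by
  exact AInfModule.ghostPow_eq_F r M N d
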